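/- **Setting.** Let $0<\epsilon<\pi/4$. Let $\{\tau_v\}_{v\in\mathbb Z^2}$ be i.i.d. $\mathrm{Exp}(1)$ random variables (vertex weights), and let $\{\theta_v\}_{v\in\mathbb Z^2}$ be i.i.d. random variables, uniform on $(\epsilon,\frac{\pi}{2}-\epsilon)$, independent of the weights. An up-right path is a finite or infinite sequence of vertices of $\mathbb Z^2$ each of whose steps is $(1,0)$ or $(0,1)$. A finite up-right path $\gamma$ from $u$ to $v$ is a *geodesic* if it maximises $\ell(\gamma)=\sum_{w\in\gamma\setminus\{u,v\}}\tau_w$ among all up-right paths from $u$ to $v$. A *semi-infinite geodesic* from $u$ is an infinite up-right path $u_0=u,u_1,u_2,\dots$ all of whose finite segments are geodesics; it has *direction* $\alpha$ if $u_k/|u_k|\to(\cos\alpha,\sin\alpha)$ as $k\to\infty$, where $|\cdot|$ is the Euclidean norm. For $u\in\mathbb Z^2$ let $\Gamma_u^{\theta_u}$ denote the (almost surely existing and unique) semi-infinite geodesic from $u$ with direction $\theta_u$; it is the trajectory of the car that starts from $u$. For an integer $n\ge 0$ let $$N_n=\bigl|\{u=(x,y)\in\mathbb Z^2:\ x+y=-n,\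 \Gamma_u^{\theta_u}\text{ exists, is unique, and contains }(0,0)\}\bigr|\in\{0,1,2,\dots\}\cup\{\infty\}.$$ **Theorem.** For every integer $n\ge 0$, the variable $N_n$ is measurable up to a null set, and $\mathbb E(N_n)=1$. -/

import Mathlib

open MeasureTheory ProbabilityTheory Filter Topology
open scoped ENNReal

namespace LPP

/-- A single step of an up-right path in `ℤ²`: one unit to the right or one unit up. -/
def IsStep (a b : ℤ × ℤ) : Prop :=
  b = a + (1, 0) ∨ b = a + (0, 1)

/-- `p 0, p 1, …, p m` is an up-right path from `u` to `v`
(the values `p k` with `k > m` are irrelevant). -/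
def IsUpRightPath (p : ℕ → ℤ × ℤ) (m : ℕ) (u v : ℤ × ℤ) : Prop :=
  p 0 = u ∧ p m = v ∧ ∀ k < m, IsStep (p k) (p (k + 1))

/-- The passage time of the path `p 0, …, p m`: the sum of the vertex weights over the
vertices of the path other than its two end points. -/
def passageTime (τ : ℤ × ℤ → ℝ) (p : ℕ → ℤ × ℤ) (m : ℕ) : ℝ :=
  ∑ k ∈ Finset.Ioo 0 m, τ (p k)

/-- `p 0, …, p m` is a geodesic from `u` to `v`: an up-right path whose passage time is maximal
among all up-right paths from `u` to `v`. -/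
def IsGeodesic (τ : ℤ × ℤ → ℝ) (p : ℕ → ℤ × ℤ) (m : ℕ) (u v : ℤ × ℤ) : Prop :=
  IsUpRightPath p m u v ∧
    ∀ (q : ℕ → ℤ × ℤ) (m' : ℕ), IsUpRightPath q m' u v → passageTime τ q m' ≤ passageTime τ p m

/-- A semi-infinite geodesic starting from `u`: an infinite up-right path from `u`
all of whose finite segments are geodesics. -/
def IsSemiInfiniteGeodesic (τ : ℤ × ℤ → ℝ) (u : ℤ × ℤ) (γ : ℕ → ℤ × ℤ) : Prop :=
  γ 0 = u ∧ (∀ k, IsStep (γ k) (γ (k + 1))) ∧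
    ∀ i m : ℕ, IsGeodesic τ (fun k => γ (i + k)) m (γ i) (γ (i + m))

/-- The Euclidean norm of a lattice point. -/
noncomputable def euclNorm (v : ℤ × ℤ) : ℝ :=
  Real.sqrt ((v.1 : ℝ) ^ 2 + (v.2 : ℝ) ^ 2)

/-- The path `γ` has direction `α`: `γ k / |γ k|` converges to the unit vector
`(cos α, sin α)` as `k → ∞`. -/
def HasDirection (γ : ℕ → ℤ × ℤ) (α : ℝ) : Prop :=
  Tendsto (fun k => ((γ k).1 : ℝ) / euclNorm (γ k)) atTop (𝓝 (Real.cos α)) ∧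
    Tendsto (fun k => ((γ k).2 : ℝ) / euclNorm (γ k)) atTop (𝓝 (Real.sin α))

/-- `γ` is the unique semi-infinite geodesic from `u` in direction `α`. -/
def IsUniqueGeodesicInDirection (τ : ℤ × ℤ → ℝ) (u : ℤ × ℤ) (α : ℝ) (γ : ℕ → ℤ × ℤ) : Prop :=
  (IsSemiInfiniteGeodesic τ u γ ∧ HasDirection γ α) ∧
    ∀ γ' : ℕ → ℤ × ℤ, IsSemiInfiniteGeodesic τ u γ' → HasDirection γ' α → γ' = γ

/-- The car that starts from `u` and chooses the direction `α` passes through `v`: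
the unique semi-infinite geodesic from `u` in direction `α` exists and contains `v`. -/
def CarPassesThrough (τ : ℤ × ℤ → ℝ) (u : ℤ × ℤ) (α : ℝ) (v : ℤ × ℤ) : Prop :=
  ∃ γ : ℕ → ℤ × ℤ, IsUniqueGeodesicInDirection τ u α γ ∧ ∃ k, γ k = v

/-- The number (possibly infinite) of cars that start from the line `x + y = -n` and pass through
the origin, when `τ` gives the vertex weights and the car at `u` chooses the direction `θ u`. -/
noncomputable def numCars (τ θ : ℤ × ℤ → ℝ) (n : ℕ) : ℝ≥0∞ :=
  (({u : ℤ × ℤ | u.1 + u.2 = -(n : ℤ) ∧ CarPassesThrough τ u (θ u) (0, 0)}.encard : ℕ∞) : ℝ≥0∞)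

end LPP

/-!
By translation invariance, the expected number of cars from the line `x + y = -n` through the
origin equals the expected number of vertices of the line `x + y = n` visited by the car from the
origin. An infinite up-right path from the origin visits exactly one such vertex, so the theorem
reduces to two facts: almost surely there is exactly one infinite geodesic in the direction chosen
by the car, and the event that it visits a given vertex is measurable up to a null set.

**Existence** uses the stationary model with parameter `ρ`: last-passage percolation in a quadrant
whose increments along the axes are independent, exponential of rate `ρ` (horizontally) and `1 -
ρ` (vertically). Burke's property (`measurePreserving_burke`) says that the update of the
increments across one cell preserves their law; sweeping over the cells, the increments along
every row and column are again independent exponential variables (`map_row_increment`,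
`map_column_increment`). Hence the increment of the stationary passage time `a` steps to the right
and `b` steps up is `a / ρ + b / (1 - ρ)` up to an error of order `(a + b) ^ (3 / 4)`, except with
a probability of order `(a + b) ^ (-3)` (`measure_dev_le_abs_lpp`). Seen backwards from a far
corner, the stationary increments bound the weights of all paths from above
(`weightSum_reflected_le`), and the path that always moves to the larger of the two preceding
values attains this bound (`exists_weightSum_reflected_eq`). So, with probability close to one,
there are arbitrarily long maximal paths whose weights follow the mean with parameter `ρ`
(`ae_hasApproxGeodesics`), while for any other parameter the mean is an asymptotic upper bound
(`ae_eventually_weightSum_le`). By compactness these paths give an infinite geodesic, and since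
`ρ` minimises `a / ρ + b / (1 - ρ)` along it, its proportion of steps to the right converges to `ρ
^ 2 / (ρ ^ 2 + (1 - ρ) ^ 2)` (`tendsto_rights_div`). Every direction in the open quadrant
corresponds to a parameter `ρ`.

**Uniqueness** holds for all but countably many directions (`steps_eq_of_tendsto`): by uniqueness
of finite geodesics two infinite geodesics that separate at a vertex never meet again, so if they
have the same direction, then it is the direction of the interface between the geodesics from this
vertex that start with a step to the right and those that start with a step up. The random
direction has no atoms and is independent of the weights, so it almost surely avoids the
interfaces of all vertices.

**Measurability** follows because, outside a null set, the geodesic visits a vertex `v` if and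
only if the approximating maximal paths can be chosen to pass through `v`
(`IsRegular.exists_steps`), a condition built from countably many conditions on finitely many
weights.
-/

namespace LPP

/-! ### Burke's property of the local update -/

/-- The local update of exponential last-passage percolation: from the increments `I`, `J` along the
lower and left sides of a unit cell and the weight `w` of its upper right corner, it computes the
increments along the upper and right sides, together with the dual weight `min I J`. The dual weight
is what makes the update a measure-preserving involution. -/
noncomputable def burke (q : ℝ × ℝ × ℝ) : ℝ × ℝ × ℝ :=
  (q.2.2 + max (q.1 - q.2.1) 0, q.2.2 + max (q.2.1 - q.1) 0, min q.1 q.2.1)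

lemma measurable_burke : Measurable burke := by
  unfold burke; fun_prop

lemma measurePreserving_shear :
    MeasurePreserving (fun q : ℝ × ℝ × ℝ => (q.2.2 + (q.1 - q.2.1), q.2.2, q.2.1)) := by
  have h : MeasurePreserving (fun q : (ℝ × ℝ) × ℝ => (Prod.swap q.1, (q.1.2 - q.1.1) + q.2))
      ((volume : Measure (ℝ × ℝ)).prod (volume : Measure ℝ))
      ((volume : Measure (ℝ × ℝ)).prod (volume : Measure ℝ)) :=
    MeasurePreserving.skew_product (g := fun a c => (a.2 - a.1) + c) Measure.measurePreserving_swap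
      (by fun_prop) (ae_of_all _ fun a => (measurePreserving_add_left volume _).map_eq)
  have h2 := (Measure.measurePreserving_swap.comp h).comp
    (Measure.measurePreserving_swap (μ := (volume : Measure ℝ)) (ν := (volume : Measure (ℝ × ℝ))))
  have e : (fun q : ℝ × ℝ × ℝ => (q.2.2 + (q.1 - q.2.1), q.2.2, q.2.1))
      = (Prod.swap ∘ fun q : (ℝ × ℝ) × ℝ => (Prod.swap q.1, (q.1.2 - q.1.1) + q.2)) ∘
        Prod.swap := by
    funext q
    simp only [Function.comp, Prod.swap]
    congr 1
    ring
  rw [e]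
  exact h2

lemma measurePreserving_swap_fst_snd :
    MeasurePreserving (fun q : ℝ × ℝ × ℝ => (q.2.1, q.1, q.2.2)) := by
  have h := (measurePreserving_prodAssoc (volume : Measure ℝ) (volume : Measure ℝ)
    (volume : Measure ℝ))
  exact h.comp (((Measure.measurePreserving_swap (μ := (volume : Measure ℝ))
    (ν := (volume : Measure ℝ))).prod (MeasurePreserving.id volume)).comp h.symm)

/-- The update is piecewise linear, with one linear map on `{J < I}` and its reflection on
`{I ≤ J}`; both preserve the volume and the respective region. -/
lemma measurePreserving_burke_volume : MeasurePreserving burke := by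
  have h1 := measurePreserving_shear
  have h2 := (measurePreserving_swap_fst_snd.comp h1).comp measurePreserving_swap_fst_snd
  refine ⟨measurable_burke, Measure.ext fun s hs => ?_⟩
  rw [Measure.map_apply measurable_burke hs]
  set A : Set (ℝ × ℝ × ℝ) := {q | q.2.1 < q.1} with hA
  have hAm : MeasurableSet A := measurableSet_lt (by fun_prop) (by fun_prop)
  rw [← measure_inter_add_sdiff (burke ⁻¹' s) hAm, ← measure_inter_add_sdiff s hAm,
    ← h1.measure_preimage (hs.inter hAm).nullMeasurableSet,
    ← h2.measure_preimage (hs.diff hAm).nullMeasurableSet]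
  congr 2
  · ext ⟨i, j, w⟩
    simp only [hA, burke, Set.mem_inter_iff, Set.mem_preimage, Set.mem_ofPred_eq]
    by_cases h : j < i
    · have : w < w + (i - j) := by linarith
      simp [h, max_eq_left (sub_pos.2 h).le, max_eq_right (sub_neg.2 h).le, min_eq_right h.le]
    · have : ¬ w < w + (i - j) := by linarith
      simp [h]
  · ext ⟨i, j, w⟩
    simp only [hA, burke, Set.mem_sdiff, Set.mem_preimage, Set.mem_ofPred_eq, Function.comp]
    by_cases h : j < i
    · simp [h]
    · have h' := not_lt.1 h
      simp [h, max_eq_left (sub_nonneg.2 h'), max_eq_right (sub_nonpos.2 h'), min_eq_left h']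

lemma expMeasure_eq_withDensity (r : ℝ) :
    expMeasure r = volume.withDensity (exponentialPDF r) := rfl

lemma measurable_exponentialPDF (r : ℝ) : Measurable (exponentialPDF r) :=
  (measurable_exponentialPDFReal r).ennreal_ofReal

/-- Burke's property: independent exponential increments and weight are mapped by the local update
to independent variables with the same laws. -/
lemma measurePreserving_burke {ρ : ℝ} (h0 : 0 < ρ) (h1 : ρ < 1) :
    MeasurePreserving burke ((expMeasure ρ).prod ((expMeasure (1 - ρ)).prod (expMeasure 1)))
      ((expMeasure ρ).prod ((expMeasure (1 - ρ)).prod (expMeasure 1))) := by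
  have m := measurable_exponentialPDF
  have := fun r : ℝ => (inferInstance : SFinite (volume.withDensity (exponentialPDF r)))
  simp only [expMeasure_eq_withDensity]
  rw [prod_withDensity (m _) (m _), prod_withDensity (m _) (by fun_prop)]
  refine ⟨measurable_burke, Measure.ext fun s hs => ?_⟩
  rw [Measure.map_apply measurable_burke hs, withDensity_apply _ (measurable_burke hs),
    withDensity_apply _ hs]
  change _ = ∫⁻ q in s, _ ∂(volume : Measure (ℝ × ℝ × ℝ))
  rw [← measurePreserving_burke_volume.setLIntegral_comp_preimage hs (by fun_prop)]
  refine lintegral_congr fun q => ?_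
  obtain ⟨i, j, w⟩ := q
  have e0 : 0 ≤ ρ := h0.le
  have e1 : 0 ≤ 1 - ρ := by linarith
  have key : ∀ a b c : ℝ, exponentialPDF ρ a * (exponentialPDF (1 - ρ) b * exponentialPDF 1 c)
      = if 0 ≤ a ∧ 0 ≤ b ∧ 0 ≤ c then
          ENNReal.ofReal (ρ * (1 - ρ) * Real.exp (-(ρ * a + (1 - ρ) * b + c))) else 0 := by
    intro a b c
    simp only [exponentialPDF_eq]
    by_cases ha : 0 ≤ a
    · by_cases hb : 0 ≤ b
      · by_cases hc : 0 ≤ c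
        · simp only [ha, hb, hc, and_self, if_true]
          rw [← ENNReal.ofReal_mul (by positivity), ← ENNReal.ofReal_mul (by positivity)]
          congr 1
          rw [show -(ρ * a + (1 - ρ) * b + c) = -(ρ * a) + (-((1 - ρ) * b) + -(1 * c)) by ring,
            Real.exp_add, Real.exp_add]
          ring
        · simp [hc]
      · simp [hb]
    · simp [ha]
  simp only [burke, key]
  rcases le_total i j with h | h
  · simp only [max_eq_right (sub_nonpos.2 h), max_eq_left (sub_nonneg.2 h), min_eq_left h, add_zero]
    have hc : (0 ≤ i ∧ 0 ≤ j ∧ 0 ≤ w) ↔ (0 ≤ w ∧ 0 ≤ w + (j - i) ∧ 0 ≤ i) := by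
      constructor <;> rintro ⟨_, _, _⟩ <;> refine ⟨?_, ?_, ?_⟩ <;> linarith
    simp only [hc]
    congr 4
    ring
  · simp only [max_eq_right (sub_nonpos.2 h), max_eq_left (sub_nonneg.2 h), min_eq_right h,
      add_zero]
    have hc : (0 ≤ i ∧ 0 ≤ j ∧ 0 ≤ w) ↔ (0 ≤ w + (i - j) ∧ 0 ≤ w ∧ 0 ≤ j) := by
      constructor <;> rintro ⟨_, _, _⟩ <;> refine ⟨?_, ?_, ?_⟩ <;> linarith
    simp only [hc]
    congr 4
    ring

/-- Apply a map of three real variables to the coordinates `a`, `b`, `c`. -/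
noncomputable def updateTriple {ι : Type*} [DecidableEq ι] (F : ℝ × ℝ × ℝ → ℝ × ℝ × ℝ) (a b c : ι)
    (s : ι → ℝ) : ι → ℝ := fun i =>
  if i = a then (F (s a, s b, s c)).1 else if i = b then (F (s a, s b, s c)).2.1
    else if i = c then (F (s a, s b, s c)).2.2 else s i

lemma measurable_updateTriple {ι : Type*} [DecidableEq ι] {F : ℝ × ℝ × ℝ → ℝ × ℝ × ℝ}
    (hF : Measurable F) (a b c : ι) : Measurable (updateTriple F a b c) := by
  refine measurable_pi_lambda _ fun i => ?_
  unfold updateTriple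
  split_ifs <;> fun_prop

lemma measurePreserving_updateTriple {ι : Type*} [DecidableEq ι] (ν : ι → Measure ℝ)
    [∀ i, IsProbabilityMeasure (ν i)] {F : ℝ × ℝ × ℝ → ℝ × ℝ × ℝ} {a b c : ι}
    (hab : a ≠ b) (hac : a ≠ c) (hbc : b ≠ c)
    (hF : MeasurePreserving F ((ν a).prod ((ν b).prod (ν c))) ((ν a).prod ((ν b).prod (ν c)))) :
    MeasurePreserving (updateTriple F a b c) (Measure.infinitePi ν) (Measure.infinitePi ν) := by
  have hm := measurable_updateTriple hF.measurable a b c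
  refine ⟨hm, ?_⟩
  have hind : iIndepFun (fun (i : ι) (s : ι → ℝ) => s i) (Measure.infinitePi ν) :=
    iIndepFun_infinitePi (X := fun i x => x) fun i => measurable_id
  have hlaw : ∀ i, (Measure.infinitePi ν).map (fun s : ι → ℝ => s i) = ν i :=
    fun i => Measure.infinitePi_map_eval ν i
  have htriple : (Measure.infinitePi ν).map (fun s : ι → ℝ => (s a, s b, s c))
      = (ν a).prod ((ν b).prod (ν c)) := by
    have h1 : IndepFun (fun s : ι → ℝ => s b) (fun s => s c) (Measure.infinitePi ν) :=
      hind.indepFun hbc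
    have h2 : IndepFun (fun s : ι → ℝ => s a) (fun s => (s b, s c)) (Measure.infinitePi ν) :=
      (hind.indepFun_prodMk (fun i => measurable_pi_apply i) b c a hab.symm hac.symm).symm
    have e := fun i : ι => (measurable_pi_apply (X := fun _ : ι => ℝ) i)
    rw [indepFun_iff_map_prod_eq_prod_map_map (e _).aemeasurable (e _).aemeasurable] at h1
    rw [indepFun_iff_map_prod_eq_prod_map_map (e _).aemeasurable
      ((e _).prodMk (e _)).aemeasurable] at h2
    rw [h2, h1, hlaw, hlaw, hlaw]
  refine Measure.eq_infinitePi ν fun S t ht => ?_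
  set t' : ι → Set ℝ := fun i => if i ∈ S then t i else Set.univ with ht'
  have ht'm : ∀ i, MeasurableSet (t' i) := fun i => by
    simp only [ht']; split_ifs <;> simp [ht]
  set T : Finset ι := {a, b, c} with hT
  have hX : IndepFun (fun s : ι → ℝ => (s a, s b, s c)) (fun s (i : (S \ T : Finset ι)) => s i)
      (Measure.infinitePi ν) := by
    have h := hind.indepFun_finset T (S \ T) Finset.disjoint_sdiff fun i => measurable_pi_apply i
    exact h.comp (φ := fun s : T → ℝ => (s ⟨a, by simp [hT]⟩, s ⟨b, by simp [hT]⟩,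
      s ⟨c, by simp [hT]⟩)) (ψ := id) (by fun_prop) measurable_id
  have hpre : updateTriple F a b c ⁻¹' (Set.pi S t) =
      ((fun s : ι → ℝ => (s a, s b, s c)) ⁻¹' (F ⁻¹' (t' a ×ˢ t' b ×ˢ t' c))) ∩
      ((fun s (i : (S \ T : Finset ι)) => s i) ⁻¹' (Set.univ.pi fun i => t i)) := by
    ext s
    have hba := hab.symm
    have hca := hac.symm
    have hcb := hbc.symm
    simp only [Set.mem_preimage, Set.mem_pi, Set.mem_inter_iff, Set.mem_prod, ht', Set.mem_univ,
      true_imp_iff, Finset.mem_coe, Subtype.forall, Finset.mem_sdiff, hT, Finset.mem_insert,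
      Finset.mem_singleton, not_or, updateTriple]
    constructor
    · intro h
      refine ⟨⟨?_, ?_, ?_⟩, fun i hi => ?_⟩
      · split_ifs with h1
        · simpa using h a h1
        · trivial
      · split_ifs with h1
        · simpa [hba] using h b h1
        · trivial
      · split_ifs with h1
        · simpa [hca, hcb] using h c h1
        · trivial
      · simpa [hi.2.1, hi.2.2.1, hi.2.2.2] using h i hi.1
    · rintro ⟨⟨h1, h2, h3⟩, h4⟩ i hi
      by_cases ha : i = a
      · subst ha; simpa [hi] using h1
      by_cases hb : i = b
      · subst hb; simpa [hi, ha] using h2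
      by_cases hc : i = c
      · subst hc; simpa [hi, ha, hb] using h3
      simpa [ha, hb, hc] using h4 i ⟨hi, ha, hb, hc⟩
  have hpi : (fun (s : ι → ℝ) (i : (S \ T : Finset ι)) => s i) ⁻¹'
        (Set.univ.pi fun i : (S \ T : Finset ι) => t i)
      = Set.pi (S \ T : Finset ι) t := by
    ext s; simp
  have hbox : MeasurableSet (t' a ×ˢ t' b ×ˢ t' c) := (ht'm a).prod ((ht'm b).prod (ht'm c))
  rw [Measure.map_apply hm (MeasurableSet.pi S.countable_toSet fun i _ => ht i), hpre,
    hX.measure_inter_preimage_eq_mul _ _ (hF.measurable hbox) (.univ_pi fun i => ht i), hpi,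
    Measure.infinitePi_pi ν fun i _ => ht i, ← Measure.map_apply (by fun_prop)
    (hF.measurable hbox), htriple, hF.measure_preimage hbox.nullMeasurableSet, Measure.prod_prod,
    Measure.prod_prod]
  have h1 : ∏ i ∈ S, ν i (t i) = ∏ i ∈ S ∪ T, ν i (t' i) := by
    rw [← Finset.prod_subset (f := fun i => ν i (t' i)) (Finset.subset_union_left (s₂ := T))
      fun i _ hi => by simp [ht', hi]]
    exact Finset.prod_congr rfl fun i hi => by simp [ht', hi]
  have h2 : ∏ i ∈ S \ T, ν i (t i) = ∏ i ∈ S \ T, ν i (t' i) :=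
    Finset.prod_congr rfl fun i hi => by simp [ht', (Finset.mem_sdiff.1 hi).1]
  rw [h1, h2, Finset.union_comm, ← Finset.union_sdiff_self_eq_union,
    Finset.prod_union Finset.disjoint_sdiff]
  congr 1
  rw [hT, Finset.prod_insert (by simp [hab, hac]), Finset.prod_pair hbc]

/-! ### The stationary last-passage model and its increments -/

/-- Indices of the independent variables driving the stationary model: horizontal boundary
increments, vertical boundary increments, and the weights of all lattice points. -/
abbrev Site := ℕ ⊕ (ℕ ⊕ (ℤ × ℤ))

/-- The rates of the exponential variables of the stationary model with parameter `ρ`. -/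
def rate (ρ : Set.Ioo (0 : ℝ) 1) : Site → ℝ
  | .inl _ => ρ
  | .inr (.inl _) => 1 - ρ
  | .inr (.inr _) => 1

lemma rate_pos (ρ : Set.Ioo (0 : ℝ) 1) (i : Site) : 0 < rate ρ i := by
  have h0 := ρ.2.1
  have h1 := ρ.2.2
  rcases i with i | i | i <;> simp only [rate] <;> linarith

instance isProbabilityMeasure_expMeasure_rate (ρ : Set.Ioo (0 : ℝ) 1) (i : Site) :
    IsProbabilityMeasure (expMeasure (rate ρ i)) :=
  isProbabilityMeasure_expMeasure (rate_pos ρ i)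

instance isProbabilityMeasure_expMeasure_one : IsProbabilityMeasure (expMeasure 1) :=
  isProbabilityMeasure_expMeasure one_pos

/-- The joint law of the boundary increments and the weights of the stationary model. -/
noncomputable def statMeasure (ρ : Set.Ioo (0 : ℝ) 1) : Measure (Site → ℝ) :=
  Measure.infinitePi fun i => expMeasure (rate ρ i)

instance isProbabilityMeasure_statMeasure (ρ : Set.Ioo (0 : ℝ) 1) :
    IsProbabilityMeasure (statMeasure ρ) := by
  unfold statMeasure; infer_instance

/-- The stationary last-passage time in the quadrant, with given increments along the two axes;
`s (.inr (.inr (x, y)))` is the weight of the lattice point `(x, y)` with `x, y ≥ 1`. -/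
noncomputable def lpp (s : Site → ℝ) : ℕ → ℕ → ℝ
  | 0, y => ∑ j ∈ Finset.range y, s (.inr (.inl j))
  | x + 1, 0 => ∑ i ∈ Finset.range (x + 1), s (.inl i)
  | x + 1, y + 1 => s (.inr (.inr ((x : ℤ) + 1, (y : ℤ) + 1)))
      + max (lpp s x (y + 1)) (lpp s (x + 1) y)

lemma lpp_zero_left (s : Site → ℝ) (y : ℕ) :
    lpp s 0 y = ∑ j ∈ Finset.range y, s (.inr (.inl j)) := by
  rw [lpp]

lemma lpp_zero_right (s : Site → ℝ) (x : ℕ) :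
    lpp s x 0 = ∑ i ∈ Finset.range x, s (.inl i) := by
  cases x <;> simp [lpp]

lemma lpp_succ_succ (s : Site → ℝ) (x y : ℕ) :
    lpp s (x + 1) (y + 1) = s (.inr (.inr ((x : ℤ) + 1, (y : ℤ) + 1)))
      + max (lpp s x (y + 1)) (lpp s (x + 1) y) := by
  rw [lpp]

lemma measurable_lpp (x y : ℕ) : Measurable fun s => lpp s x y := by
  induction x generalizing y with
  | zero => simp only [lpp_zero_left]; fun_prop
  | succ x ihx =>
    induction y with
    | zero => simp only [lpp_zero_right]; fun_prop
    | succ y ihy =>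
      simp only [lpp_succ_succ]
      exact (measurable_pi_apply _).add ((ihx _).max ihy)

/-- Pass from the increments along the lower and left sides of the cell with lower left corner
`(x, y)` to those along its upper and right sides. -/
noncomputable def cellUpdate (x y : ℕ) : (Site → ℝ) → Site → ℝ :=
  updateTriple burke (.inl x) (.inr (.inl y)) (.inr (.inr ((x : ℤ) + 1, (y : ℤ) + 1)))

lemma measurePreserving_cellUpdate (ρ : Set.Ioo (0 : ℝ) 1) (x y : ℕ) :
    MeasurePreserving (cellUpdate x y) (statMeasure ρ) (statMeasure ρ) :=
  measurePreserving_updateTriple _ (by simp) (by simp) (by simp)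
    (measurePreserving_burke ρ.2.1 ρ.2.2)

/-- Update the first cells of the row at height `y`. -/
noncomputable def rowSweep (y : ℕ) : ℕ → (Site → ℝ) → Site → ℝ
  | 0, s => s
  | x + 1, s => cellUpdate x y (rowSweep y x s)

/-- Update the first `n` cells of each of the first rows. -/
noncomputable def sweep (n : ℕ) : ℕ → (Site → ℝ) → Site → ℝ
  | 0, s => s
  | y + 1, s => rowSweep y n (sweep n y s)

lemma measurePreserving_rowSweep (ρ : Set.Ioo (0 : ℝ) 1) (y x : ℕ) :
    MeasurePreserving (rowSweep y x) (statMeasure ρ) (statMeasure ρ) := by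
  induction x with
  | zero => exact MeasurePreserving.id _
  | succ x ih => exact (measurePreserving_cellUpdate ρ x y).comp ih

lemma measurePreserving_sweep (ρ : Set.Ioo (0 : ℝ) 1) (n y : ℕ) :
    MeasurePreserving (sweep n y) (statMeasure ρ) (statMeasure ρ) := by
  induction y with
  | zero => exact MeasurePreserving.id _
  | succ y ih => exact (measurePreserving_rowSweep ρ y n).comp ih

/-- The state `T` of the sweep just before the cell at `(x, y)` is updated: it contains the current
increments of the last-passage time and the weights that have not been used yet. -/
structure SweepState (n : ℕ) (s T : Site → ℝ) (x y : ℕ) : Prop where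
  left : ∀ i < x, T (.inl i) = lpp s (i + 1) (y + 1) - lpp s i (y + 1)
  right : ∀ i, x ≤ i → i < n → T (.inl i) = lpp s (i + 1) y - lpp s i y
  side : T (.inr (.inl y)) = lpp s x (y + 1) - lpp s x y
  above : ∀ j, y < j → T (.inr (.inl j)) = s (.inr (.inl j))
  weight : ∀ i j : ℕ, y < j ∨ (j = y ∧ x ≤ i) →
    T (.inr (.inr ((i : ℤ) + 1, (j : ℤ) + 1))) = s (.inr (.inr ((i : ℤ) + 1, (j : ℤ) + 1)))

lemma SweepState.cellUpdate {n : ℕ} {s T : Site → ℝ} {x y : ℕ} (h : SweepState n s T x y)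
    (hxn : x < n) : SweepState n s (cellUpdate x y T) (x + 1) y := by
  have hr := lpp_succ_succ s x y
  have hx := h.right x le_rfl hxn
  have hw := h.weight x y (Or.inr ⟨rfl, le_rfl⟩)
  have hs := h.side
  have max1 : ∀ a b : ℝ, max (a - b) 0 = max a b - b := fun a b => by
    rw [← max_sub_sub_right, sub_self]
  constructor
  · intro i hi
    rcases Nat.lt_succ_iff_lt_or_eq.1 hi with hi | rfl
    · simpa [LPP.cellUpdate, updateTriple, hi.ne] using h.left i hi
    · simp only [LPP.cellUpdate, updateTriple, burke, if_true, hx, hw, hs, hr, max1]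
      rw [max_sub_sub_right, max_comm]
      ring
  · intro i hi hin
    have : i ≠ x := by omega
    simpa [LPP.cellUpdate, updateTriple, this] using h.right i (by omega) hin
  · simp only [LPP.cellUpdate, updateTriple, burke, if_true, hx, hw, hs, hr, max1, reduceCtorEq,
      if_false]
    rw [max_sub_sub_right]
    ring
  · intro j hj
    simpa [LPP.cellUpdate, updateTriple, hj.ne'] using h.above j hj
  · intro i j hij
    have : ¬ (i = x ∧ j = y) := by omega
    simpa [LPP.cellUpdate, updateTriple, this] using h.weight i j (by omega)

lemma SweepState.rowSweep {n : ℕ} {s T : Site → ℝ} {y : ℕ} (h : SweepState n s T 0 y) {x : ℕ}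
    (hx : x ≤ n) : SweepState n s (rowSweep y x T) x y := by
  induction x with
  | zero => exact h
  | succ x ih => exact (ih (by omega)).cellUpdate (by omega)

lemma sweepState_sweep (n : ℕ) (s : Site → ℝ) (y : ℕ) : SweepState n s (sweep n y s) 0 y := by
  induction y with
  | zero =>
    constructor
    · simp
    · intro i _ _
      simp [sweep, lpp_zero_right, Finset.sum_range_succ]
    · simp [sweep, lpp_zero_left]
    · simp [sweep]
    · simp [sweep]
  | succ y ih =>
    have h := ih.rowSweep le_rfl
    constructor
    · simp
    · intro i _ hi
      exact h.left i hi
    · rw [lpp_zero_left, lpp_zero_left, Finset.sum_range_succ, add_sub_cancel_left]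
      exact h.above (y + 1) (by omega)
    · intro j hj
      exact h.above j (by omega)
    · intro i j hij
      exact h.weight i j (by omega)

/-- Along each row, the increments of the stationary last-passage time have the joint law of the
increments along the bottom row. -/
lemma map_row_increment (ρ : Set.Ioo (0 : ℝ) 1) (x a y : ℕ) :
    (statMeasure ρ).map (fun s => lpp s (x + a) y - lpp s x y)
      = (statMeasure ρ).map (fun s => ∑ i ∈ Finset.range a, s (.inl (x + i))) := by
  have h := (measurePreserving_sweep ρ (x + a) y)
  have e : (fun s => lpp s (x + a) y - lpp s x y)
      = (fun s : Site → ℝ => ∑ i ∈ Finset.range a, s (.inl (x + i))) ∘ sweep (x + a) y := by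
    funext s
    have hi : ∀ i ∈ Finset.range a, sweep (x + a) y s (.inl (x + i))
        = lpp s (x + (i + 1)) y - lpp s (x + i) y := fun i hi =>
      (sweepState_sweep (x + a) s y).right (x + i) (Nat.zero_le _)
        (by have := Finset.mem_range.1 hi; omega)
    simp only [Function.comp]
    rw [Finset.sum_congr rfl hi, Finset.sum_range_sub (fun i => lpp s (x + i) y)]
    simp
  rw [e, ← Measure.map_map (by fun_prop) h.measurable, h.map_eq]

/-- Reflection in the diagonal. -/
def siteSwap : Site → Site
  | .inl i => .inr (.inl i)
  | .inr (.inl i) => .inl i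
  | .inr (.inr v) => .inr (.inr (v.2, v.1))

lemma siteSwap_injective : Function.Injective siteSwap := by
  rintro (i | i | ⟨i, i'⟩) (j | j | ⟨j, j'⟩) h <;> simp_all [siteSwap]

/-- The parameter of the reflected model. -/
def symmParam (ρ : Set.Ioo (0 : ℝ) 1) : Set.Ioo (0 : ℝ) 1 :=
  ⟨1 - ρ, by linarith [ρ.2.2], by linarith [ρ.2.1]⟩

lemma map_siteSwap (ρ : Set.Ioo (0 : ℝ) 1) :
    (statMeasure ρ).map (fun s i => s (siteSwap i)) = statMeasure (symmParam ρ) := by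
  unfold statMeasure
  rw [Measure.map_infinitePi_infinitePi_of_inj siteSwap_injective]
  congr 1
  funext i
  rcases i with i | i | i <;> simp [siteSwap, rate, symmParam]

lemma lpp_siteSwap (s : Site → ℝ) (x y : ℕ) :
    lpp (fun i => s (siteSwap i)) x y = lpp s y x := by
  induction x generalizing y with
  | zero => simp [lpp_zero_left, lpp_zero_right, siteSwap]
  | succ x ihx =>
    induction y with
    | zero => simp [lpp_zero_left, lpp_zero_right, siteSwap]
    | succ y ihy => rw [lpp_succ_succ, ihx, ihy, lpp_succ_succ s, max_comm]; simp [siteSwap]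

/-- Along each column, the increments of the stationary last-passage time have the joint law of the
increments along the left column. -/
lemma map_column_increment (ρ : Set.Ioo (0 : ℝ) 1) (x y b : ℕ) :
    (statMeasure ρ).map (fun s => lpp s x (y + b) - lpp s x y)
      = (statMeasure ρ).map (fun s => ∑ j ∈ Finset.range b, s (.inr (.inl (y + j)))) := by
  have hm : Measurable fun (s : Site → ℝ) i => s (siteSwap i) := by fun_prop
  have h := map_row_increment (symmParam ρ) y b x
  rw [← map_siteSwap, Measure.map_map (by have := measurable_lpp; fun_prop) hm,
    Measure.map_map (by fun_prop) hm] at h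
  simp only [Function.comp_def, lpp_siteSwap] at h
  exact h

/-! ### Tail bounds for the increments -/

/-- The allowed fluctuation `k ^ (3 / 4)` of passage times over `k` steps. -/
noncomputable def dev (k : ℕ) : ℝ := √(k : ℝ) * √√(k : ℝ)

lemma lintegral_exp_mul_expMeasure {r t : ℝ} (hr : 0 < r) (ht : t < r) :
    ∫⁻ x, ENNReal.ofReal (Real.exp (t * x)) ∂(expMeasure r) = ENNReal.ofReal (r / (r - t)) := by
  have hrt : 0 < r - t := sub_pos.2 ht
  rw [expMeasure_eq_withDensity, lintegral_withDensity_eq_lintegral_mul _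
    (measurable_exponentialPDF r) (by fun_prop)]
  have e : ∀ x, (exponentialPDF r * fun x => ENNReal.ofReal (Real.exp (t * x))) x
      = ENNReal.ofReal (r / (r - t)) * exponentialPDF (r - t) x := by
    intro x
    simp only [Pi.mul_apply, exponentialPDF_eq]
    by_cases hx : 0 ≤ x
    · simp only [hx, if_true]
      rw [← ENNReal.ofReal_mul (by positivity), ← ENNReal.ofReal_mul (by positivity), mul_assoc,
        ← Real.exp_add, ← mul_assoc, div_mul_cancel₀ _ hrt.ne']
      ring_nf
    · simp [hx]
  simp_rw [e]
  rw [lintegral_const_mul _ (measurable_exponentialPDF _), lintegral_exponentialPDF_eq_one hrt,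
    mul_one]

lemma integrable_exp_mul_expMeasure {r t : ℝ} (hr : 0 < r) (ht : t < r) :
    Integrable (fun x => Real.exp (t * x)) (expMeasure r) := by
  refine ⟨by fun_prop, ?_⟩
  rw [hasFiniteIntegral_iff_ofReal (ae_of_all _ fun x => (Real.exp_pos _).le),
    lintegral_exp_mul_expMeasure hr ht]
  exact ENNReal.ofReal_lt_top

lemma mgf_expMeasure {r t : ℝ} (hr : 0 < r) (ht : t < r) :
    mgf id (expMeasure r) t = r / (r - t) := by
  rw [mgf, integral_eq_lintegral_of_nonneg_ae (ae_of_all _ fun x => (Real.exp_pos _).le)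
    (by fun_prop)]
  simp only [id]
  rw [lintegral_exp_mul_expMeasure hr ht, ENNReal.toReal_ofReal]
  exact (div_pos hr (sub_pos.2 ht)).le

lemma mgf_expMeasure_le {r t : ℝ} (hr : 0 < r) (ht : |t| ≤ r / 2) :
    mgf id (expMeasure r) t ≤ Real.exp (t / r + 2 * (t / r) ^ 2) := by
  obtain ⟨h1, h2⟩ := abs_le.1 ht
  rw [mgf_expMeasure hr (by linarith)]
  set x := t / r with hx
  have hx1 : x ≤ 1 / 2 := by rw [hx, div_le_iff₀ hr]; linarith
  have e : r / (r - t) = 1 / (1 - x) := by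
    rw [hx, one_sub_div hr.ne', one_div_div]
  rw [e, div_le_iff₀ (by linarith)]
  have h3 := Real.add_one_le_exp (x + 2 * x ^ 2)
  have h4 : 0 ≤ 1 - x := by linarith
  nlinarith [mul_le_mul_of_nonneg_right h3 h4, mul_nonneg (sq_nonneg x) (sub_nonneg.2 hx1)]

section Chernoff

variable (ρ : Set.Ioo (0 : ℝ) 1)

lemma iIndepFun_coord : iIndepFun (fun (i : Site) (s : Site → ℝ) => s i) (statMeasure ρ) :=
  iIndepFun_infinitePi (X := fun _ x => x) fun _ => measurable_id

lemma map_coord (i : Site) : (statMeasure ρ).map (fun s => s i) = expMeasure (rate ρ i) :=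
  Measure.infinitePi_map_eval (fun i => expMeasure (rate ρ i)) i

lemma mgf_sum_coord_le {f : ℕ → Site} (hf : Function.Injective f) {r : ℝ} (hr : 0 < r)
    (hfr : ∀ i, rate ρ (f i) = r) (a : ℕ) {t : ℝ} (ht : |t| ≤ r / 2) :
    mgf (fun s => ∑ i ∈ Finset.range a, s (f i)) (statMeasure ρ) t
      ≤ Real.exp (a * (t / r + 2 * (t / r) ^ 2)) := by
  have h := ((iIndepFun_coord ρ).precomp hf).mgf_sum (t := t) (fun i => measurable_pi_apply _)
    (Finset.range a)
  have e : (∑ i ∈ Finset.range a, fun s : Site → ℝ => s (f i))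
      = fun s => ∑ i ∈ Finset.range a, s (f i) := by
    funext s; simp
  rw [e] at h
  have h1 : ∀ i, mgf (fun s : Site → ℝ => s (f i)) (statMeasure ρ) t = mgf id (expMeasure r) t := by
    intro i
    rw [← hfr i, ← map_coord, mgf_id_map (measurable_pi_apply _).aemeasurable]
  rw [h, Finset.prod_congr rfl fun i _ => h1 i, Finset.prod_const, Finset.card_range,
    Real.exp_nat_mul]
  exact pow_le_pow_left₀ mgf_nonneg (mgf_expMeasure_le hr ht) a

lemma integrable_exp_sum_coord {f : ℕ → Site} (hf : Function.Injective f) {r : ℝ} (hr : 0 < r)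
    (hfr : ∀ i, rate ρ (f i) = r) (a : ℕ) {t : ℝ} (ht : |t| ≤ r / 2) :
    Integrable (fun s => Real.exp (t * ∑ i ∈ Finset.range a, s (f i))) (statMeasure ρ) := by
  have h := ((iIndepFun_coord ρ).precomp hf).integrable_exp_mul_sum (t := t)
    (fun i => measurable_pi_apply _) (s := Finset.range a) fun i _ => by
      have h1 := integrable_exp_mul_expMeasure (t := t) hr (by linarith [(abs_le.1 ht).2])
      rw [← hfr i, ← map_coord] at h1
      exact h1.comp_measurable (measurable_pi_apply _)
  simpa using h

lemma measure_le_abs_sum_coord {f : ℕ → Site} (hf : Function.Injective f) {r : ℝ} (hr : 0 < r)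
    (hfr : ∀ i, rate ρ (f i) = r) (a : ℕ) {t D : ℝ} (ht0 : 0 ≤ t) (ht : t ≤ r / 2) :
    (statMeasure ρ).real {s | D ≤ |∑ i ∈ Finset.range a, s (f i) - a / r|}
      ≤ 2 * Real.exp (-(t * D) + 2 * a * (t / r) ^ 2) := by
  have hta : |t| ≤ r / 2 := by rwa [abs_of_nonneg ht0]
  have hta' : |-t| ≤ r / 2 := by rwa [abs_neg]
  have h1 := measure_ge_le_exp_mul_mgf (D + a / r) ht0 (integrable_exp_sum_coord ρ hf hr hfr a hta)
  have h2 := measure_le_le_exp_mul_mgf (-D + a / r) (neg_nonpos.2 ht0)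
    (integrable_exp_sum_coord ρ hf hr hfr a hta')
  have h3 := mgf_sum_coord_le ρ hf hr hfr a hta
  have h4 := mgf_sum_coord_le ρ hf hr hfr a hta'
  have h5 : {s : Site → ℝ | D ≤ |∑ i ∈ Finset.range a, s (f i) - a / r|} ⊆
      {s | D + a / r ≤ ∑ i ∈ Finset.range a, s (f i)} ∪
      {s | ∑ i ∈ Finset.range a, s (f i) ≤ -D + a / r} := by
    intro s hs
    rcases le_abs.1 (show D ≤ |∑ i ∈ Finset.range a, s (f i) - a / r| from hs) with h | h
    · left; rw [Set.mem_ofPred_eq]; linarith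
    · right; rw [Set.mem_ofPred_eq]; linarith
  have h6 := (measureReal_mono h5 (measure_ne_top (statMeasure ρ) _)).trans
    (measureReal_union_le _ _)
  have h7 : Real.exp (-t * (D + a / r)) * Real.exp (a * (t / r + 2 * (t / r) ^ 2))
      = Real.exp (-(t * D) + 2 * a * (t / r) ^ 2) := by
    rw [← Real.exp_add]; congr 1; ring
  have h8 : Real.exp (- -t * (-D + a / r)) * Real.exp (a * (-t / r + 2 * (-t / r) ^ 2))
      = Real.exp (-(t * D) + 2 * a * (t / r) ^ 2) := by
    rw [← Real.exp_add]; congr 1; ring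
  have h9 := mul_le_mul_of_nonneg_left h3 (Real.exp_pos (-t * (D + a / r))).le
  have h10 := mul_le_mul_of_nonneg_left h4 (Real.exp_pos (- -t * (-D + a / r))).le
  rw [h7] at h9
  rw [h8] at h10
  linarith

/-- Fluctuations of order `k ^ (3 / 4)` of a sum of at most `k` independent exponential variables
have a probability of order at most `k ^ (-3)`. -/
lemma measure_dev_le_abs_sum_coord {f : ℕ → Site} (hf : Function.Injective f) {r : ℝ} (hr : 0 < r)
    (hr1 : r ≤ 1) (hfr : ∀ i, rate ρ (f i) = r) {a k : ℕ} (hk : 0 < k) (hak : a ≤ k) :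
    (statMeasure ρ).real {s | dev k / 2 ≤ |∑ i ∈ Finset.range a, s (f i) - a / r|}
      ≤ 1440 / (r ^ 2 / 32) ^ 6 / (k : ℝ) ^ 3 := by
  have hk1 : (1 : ℝ) ≤ k := by exact_mod_cast hk
  set q := √√(k : ℝ) with hq
  have hq2 : q ^ 2 = √(k : ℝ) := Real.sq_sqrt (Real.sqrt_nonneg _)
  have hq4 : q ^ 4 = k := by
    rw [show q ^ 4 = (q ^ 2) ^ 2 by ring, hq2, Real.sq_sqrt (by linarith)]
  have hq1 : 1 ≤ q := by
    rw [hq]; exact Real.one_le_sqrt.2 (Real.one_le_sqrt.2 hk1)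
  have hq0 : 0 < q := by linarith
  have hdev : dev k = q ^ 3 := by rw [dev, ← hq, ← hq2]; ring
  -- The optimal order of the Chernoff parameter is `k ^ (-1 / 4)`.
  have ht : r ^ 2 / 8 / q ≤ r / 2 := by
    rw [div_le_iff₀ hq0]; nlinarith
  refine (measure_le_abs_sum_coord ρ hf hr hfr a (t := r ^ 2 / 8 / q) (by positivity) ht).trans ?_
  have e1 : -(r ^ 2 / 8 / q * (dev k / 2)) + 2 * a * (r ^ 2 / 8 / q / r) ^ 2
      ≤ -(r ^ 2 / 32 * q ^ 2) := by
    have e2 : r ^ 2 / 8 / q * (dev k / 2) = r ^ 2 / 16 * q ^ 2 := by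
      rw [hdev]; field_simp; norm_num
    have e3 : 2 * (k : ℝ) * (r ^ 2 / 8 / q / r) ^ 2 = r ^ 2 / 32 * q ^ 2 := by
      rw [← hq4]; field_simp; norm_num
    have e4 : 2 * (a : ℝ) * (r ^ 2 / 8 / q / r) ^ 2 ≤ 2 * (k : ℝ) * (r ^ 2 / 8 / q / r) ^ 2 := by
      gcongr
    rw [e2]; linarith
  have hy : 0 < r ^ 2 / 32 * q ^ 2 := by positivity
  have h6 := Real.pow_div_factorial_le_exp _ hy.le 6
  have h7 : Real.exp (-(r ^ 2 / 32 * q ^ 2)) ≤ 720 / (r ^ 2 / 32 * q ^ 2) ^ 6 := by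
    rw [Real.exp_neg, inv_le_comm₀ (Real.exp_pos _) (by positivity), inv_div]
    simpa [Nat.factorial] using h6
  have h8 : (r ^ 2 / 32 * q ^ 2) ^ 6 = (r ^ 2 / 32) ^ 6 * (k : ℝ) ^ 3 := by
    rw [← hq4]; ring
  rw [h8] at h7
  calc _ ≤ 2 * Real.exp (-(r ^ 2 / 32 * q ^ 2)) := by gcongr
    _ ≤ 2 * (720 / ((r ^ 2 / 32) ^ 6 * (k : ℝ) ^ 3)) := by gcongr
    _ = _ := by rw [div_div]; ring

/-- The constant in the tail bound for the increments of the stationary model. -/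
noncomputable def tailConst : ℝ :=
  1440 / ((ρ : ℝ) ^ 2 / 32) ^ 6 + 1440 / ((1 - ρ : ℝ) ^ 2 / 32) ^ 6

/-- The mean of the increment `a` steps to the right and `b` steps up, in the stationary model with
parameter `r`. -/
noncomputable def meanIncr (r : ℝ) (a b : ℕ) : ℝ := a / r + b / (1 - r)

/-- The increments of the stationary last-passage time stay close to their means. -/
lemma measure_dev_le_abs_lpp (x y : ℕ) {a b k : ℕ} (hk : 0 < k) (hab : a + b = k) :
    (statMeasure ρ).real {s | dev k ≤ |lpp s (x + a) (y + b) - lpp s x y - meanIncr ρ a b|}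
      ≤ tailConst ρ / (k : ℝ) ^ 3 := by
  have h0 := ρ.2.1
  have h1 := ρ.2.2
  have m := measurable_lpp
  have hrow := measure_dev_le_abs_sum_coord ρ (f := fun i => .inl (x + i))
    (fun i j h => by simpa using h) h0 h1.le (fun _ => rfl) hk (show a ≤ k by omega)
  have hcol := measure_dev_le_abs_sum_coord ρ (f := fun j => .inr (.inl (y + j)))
    (fun i j h => by simpa using h) (r := 1 - ρ) (by linarith) (by linarith) (fun _ => rfl) hk
    (show b ≤ k by omega)
  have hset : ∀ (c : ℝ), MeasurableSet {z : ℝ | dev k / 2 ≤ |z - c|} := fun c =>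
    measurableSet_le (by fun_prop) (by fun_prop)
  have hrow' : (statMeasure ρ).real
        {s | dev k / 2 ≤ |lpp s (x + a) (y + b) - lpp s x (y + b) - a / ρ|}
      = (statMeasure ρ).real
        {s | dev k / 2 ≤ |∑ i ∈ Finset.range a, s (.inl (x + i)) - a / (ρ : ℝ)|} := by
    have h := congrArg (fun ν => ν.real {z : ℝ | dev k / 2 ≤ |z - a / (ρ : ℝ)|})
      (map_row_increment ρ x a (y + b))
    rwa [map_measureReal_apply (by fun_prop) (hset _), map_measureReal_apply (by fun_prop) (hset _)]
      at h
  have hcol' : (statMeasure ρ).real {s | dev k / 2 ≤ |lpp s x (y + b) - lpp s x y - b / (1 - ρ)|}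
      = (statMeasure ρ).real
        {s | dev k / 2 ≤ |∑ j ∈ Finset.range b, s (.inr (.inl (y + j))) - b / (1 - ρ : ℝ)|} := by
    have h := congrArg (fun ν => ν.real {z : ℝ | dev k / 2 ≤ |z - b / (1 - ρ : ℝ)|})
      (map_column_increment ρ x y b)
    rwa [map_measureReal_apply (by fun_prop) (hset _), map_measureReal_apply (by fun_prop) (hset _)]
      at h
  rw [← hrow'] at hrow
  rw [← hcol'] at hcol
  have hsub : {s : Site → ℝ | dev k ≤ |lpp s (x + a) (y + b) - lpp s x y - meanIncr ρ a b|} ⊆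
      {s | dev k / 2 ≤ |lpp s (x + a) (y + b) - lpp s x (y + b) - a / ρ|} ∪
      {s | dev k / 2 ≤ |lpp s x (y + b) - lpp s x y - b / (1 - ρ)|} := by
    intro s hs
    by_contra hcon
    simp only [Set.mem_union, Set.mem_ofPred_eq, not_or, not_le] at hcon hs
    have h3 := abs_add_le (lpp s (x + a) (y + b) - lpp s x (y + b) - a / (ρ : ℝ))
      (lpp s x (y + b) - lpp s x y - b / (1 - ρ : ℝ))
    have h4 : lpp s (x + a) (y + b) - lpp s x (y + b) - a / (ρ : ℝ)
        + (lpp s x (y + b) - lpp s x y - b / (1 - ρ : ℝ))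
        = lpp s (x + a) (y + b) - lpp s x y - meanIncr ρ a b := by
      rw [meanIncr]; ring
    rw [h4] at h3
    linarith [hcon.1, hcon.2]
  refine ((measureReal_mono hsub (measure_ne_top (statMeasure ρ) _)).trans
    (measureReal_union_le _ _)).trans ?_
  rw [tailConst, add_div]
  exact add_le_add hrow hcol

end Chernoff

/-! ### Paths from the origin and their approximation by the stationary model -/

/-- The number of steps to the right among the first `k` steps of the path with steps `s`
(`true` means right, `false` means up). -/
def rights (s : ℕ → Bool) : ℕ → ℕ
  | 0 => 0
  | k + 1 => rights s k + (s k).toNat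

/-- The number of steps up among the first `k` steps. -/
def ups (s : ℕ → Bool) : ℕ → ℕ
  | 0 => 0
  | k + 1 => ups s k + (!s k).toNat

/-- The up-right path from the origin with steps `s`. -/
def stepPath (s : ℕ → Bool) (k : ℕ) : ℤ × ℤ := (rights s k, ups s k)

/-- The total weight of the first `k` vertices, including the origin. -/
noncomputable def weightSum (τ : ℤ × ℤ → ℝ) (s : ℕ → Bool) (k : ℕ) : ℝ :=
  ∑ i ∈ Finset.range k, τ (stepPath s i)

/-- The first `N` steps `s` form a path from the origin of maximal weight. -/
def IsMaximal (τ : ℤ × ℤ → ℝ) (s : ℕ → Bool) (N : ℕ) : Prop :=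
  ∀ t, stepPath t N = stepPath s N → weightSum τ t N ≤ weightSum τ s N

/-- From time `K` on, the weight of the path is not much smaller than the mean of the corresponding
increment of the stationary model with parameter `r`. -/
def FollowsMean (r : ℝ) (τ : ℤ × ℤ → ℝ) (s : ℕ → Bool) (N K : ℕ) : Prop :=
  ∀ k ≤ N, K < k → meanIncr r (rights s k) (ups s k) - dev k ≤ weightSum τ s k

lemma rights_add_ups (s : ℕ → Bool) (k : ℕ) : rights s k + ups s k = k := by
  induction k with
  | zero => rfl
  | succ k ih => rw [rights, ups]; cases s k <;> simp <;> omega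

lemma rights_congr {s t : ℕ → Bool} {k : ℕ} (h : ∀ i < k, s i = t i) : rights s k = rights t k := by
  induction k with
  | zero => rfl
  | succ k ih => rw [rights, rights, ih fun i hi => h i (by omega), h k (by omega)]

lemma ups_congr {s t : ℕ → Bool} {k : ℕ} (h : ∀ i < k, s i = t i) : ups s k = ups t k := by
  have h1 := rights_add_ups s k
  have h2 := rights_add_ups t k
  have h3 := rights_congr h
  omega

lemma stepPath_congr {s t : ℕ → Bool} {k : ℕ} (h : ∀ i < k, s i = t i) :
    stepPath s k = stepPath t k := by
  rw [stepPath, stepPath, rights_congr h, ups_congr h]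

lemma weightSum_congr (τ : ℤ × ℤ → ℝ) {s t : ℕ → Bool} {k : ℕ} (h : ∀ i < k, s i = t i) :
    weightSum τ s k = weightSum τ t k :=
  Finset.sum_congr rfl fun i hi => by
    rw [stepPath_congr fun j hj => h j (hj.trans (Finset.mem_range.1 hi))]

lemma IsMaximal.congr {τ : ℤ × ℤ → ℝ} {s t : ℕ → Bool} {N : ℕ} (hs : IsMaximal τ s N)
    (h : ∀ i < N, s i = t i) : IsMaximal τ t N := fun u hu => by
  rw [← weightSum_congr τ h]
  exact hs u (hu.trans (stepPath_congr h).symm)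

lemma FollowsMean.congr {r : ℝ} {τ : ℤ × ℤ → ℝ} {s t : ℕ → Bool} {N K : ℕ}
    (hs : FollowsMean r τ s N K) (h : ∀ i < N, s i = t i) : FollowsMean r τ t N K := by
  intro k hk hK
  have h' : ∀ i < k, s i = t i := fun i hi => h i (by omega)
  rw [← weightSum_congr τ h', ← rights_congr h', ← ups_congr h']
  exact hs k hk hK

lemma stepPath_eq_iff {s t : ℕ → Bool} {k : ℕ} :
    stepPath s k = stepPath t k ↔ rights s k = rights t k := by
  have h1 := rights_add_ups s k
  have h2 := rights_add_ups t k
  simp only [stepPath, Prod.mk.injEq, Nat.cast_inj]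
  omega

/-- The path that follows `t` for `m` steps and continues with the steps of `s`. -/
def splice (t s : ℕ → Bool) (m i : ℕ) : Bool := if i < m then t i else s i

lemma stepPath_splice_of_le (t s : ℕ → Bool) {m k : ℕ} (h : k ≤ m) :
    stepPath (splice t s m) k = stepPath t k :=
  stepPath_congr fun i hi => by simp [splice, hi.trans_le h]

lemma rights_splice (t s : ℕ → Bool) (m j : ℕ) (h : rights t m = rights s m) :
    rights (splice t s m) (m + j) = rights s (m + j) := by
  induction j with
  | zero => rw [add_zero, ← h]; exact rights_congr fun i hi => by simp [splice, hi]
  | succ j ih => rw [← add_assoc, rights, rights, ih]; simp [splice]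

/-- An initial segment of a maximal path is maximal. -/
lemma IsMaximal.mono {τ : ℤ × ℤ → ℝ} {s : ℕ → Bool} {N m : ℕ} (hs : IsMaximal τ s N) (hm : m ≤ N) :
    IsMaximal τ s m := by
  intro t ht
  obtain ⟨j, rfl⟩ := Nat.exists_eq_add_of_le hm
  have hr := stepPath_eq_iff.1 ht
  have h := hs (splice t s m) (stepPath_eq_iff.2 (rights_splice t s m j hr))
  simp only [weightSum, Finset.sum_range_add] at h ⊢
  have h1 : ∑ i ∈ Finset.range m, τ (stepPath (splice t s m) i)
      = ∑ i ∈ Finset.range m, τ (stepPath t i) :=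
    Finset.sum_congr rfl fun i hi => by
      rw [stepPath_splice_of_le t s (Finset.mem_range.1 hi).le]
  have h2 : ∑ i ∈ Finset.range j, τ (stepPath (splice t s m) (m + i))
      = ∑ i ∈ Finset.range j, τ (stepPath s (m + i)) :=
    Finset.sum_congr rfl fun i _ => by rw [stepPath_eq_iff.2 (rights_splice t s m i hr)]
  linarith

lemma FollowsMean.mono {r : ℝ} {τ : ℤ × ℤ → ℝ} {s : ℕ → Bool} {N m K : ℕ}
    (hs : FollowsMean r τ s N K) (hm : m ≤ N) : FollowsMean r τ s m K :=
  fun k hk hK => hs k (hk.trans hm) hK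

section Reflection

/-- The weights seen from the lattice point `(N, N)` when looking backwards. -/
def reflectedWeight (N : ℕ) (σ : Site → ℝ) (v : ℤ × ℤ) : ℝ :=
  σ (.inr (.inr ((N : ℤ) - v.1, (N : ℤ) - v.2)))

variable (N : ℕ) (σ : Site → ℝ)

lemma lpp_reflected (s : ℕ → Bool) {k : ℕ} (hk : k < N) :
    ∃ x y, N - rights s k = x + 1 ∧ N - ups s k = y + 1 ∧
      lpp σ (N - rights s k) (N - ups s k)
        = reflectedWeight N σ (stepPath s k) + max (lpp σ x (y + 1)) (lpp σ (x + 1) y) := by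
  have h := rights_add_ups s k
  obtain ⟨x, hx⟩ : ∃ x, N - rights s k = x + 1 := ⟨N - rights s k - 1, by omega⟩
  obtain ⟨y, hy⟩ : ∃ y, N - ups s k = y + 1 := ⟨N - ups s k - 1, by omega⟩
  refine ⟨x, y, hx, hy, ?_⟩
  have e1 : (N : ℤ) - rights s k = x + 1 := by omega
  have e2 : (N : ℤ) - ups s k = y + 1 := by omega
  rw [hx, hy, lpp_succ_succ, reflectedWeight, stepPath]
  simp only [e1, e2]

/-- Each weight is at most the corresponding increment of the stationary last-passage time. -/
lemma weightSum_reflected_le (t : ℕ → Bool) {k : ℕ} (hk : k ≤ N) :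
    weightSum (reflectedWeight N σ) t k ≤ lpp σ N N - lpp σ (N - rights t k) (N - ups t k) := by
  induction k with
  | zero => simp [weightSum, rights, ups]
  | succ k ih =>
    obtain ⟨x, y, hx, hy, e⟩ := lpp_reflected N σ t (show k < N by omega)
    have h := ih (by omega)
    rw [weightSum, Finset.sum_range_succ, ← weightSum, rights, ups]
    cases hs : t k
    · have e1 : N - (ups t k + 1) = y := by omega
      simp only [Bool.toNat_false, Bool.not_false, Bool.toNat_true, add_zero, e1, hx]
      linarith [le_max_right (lpp σ x (y + 1)) (lpp σ (x + 1) y)]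
    · have e1 : N - (rights t k + 1) = x := by omega
      simp only [Bool.toNat_false, Bool.not_true, Bool.toNat_true, add_zero, e1, hy]
      linarith [le_max_left (lpp σ x (y + 1)) (lpp σ (x + 1) y)]

/-- Following the larger of the two preceding values of the stationary last-passage time gives a
path whose weights add up to its increments. -/
lemma exists_weightSum_reflected_eq {k : ℕ} (hk : k ≤ N) : ∃ t : ℕ → Bool, ∀ j ≤ k,
    weightSum (reflectedWeight N σ) t j = lpp σ N N - lpp σ (N - rights t j) (N - ups t j) := by
  induction k with
  | zero => exact ⟨fun _ => true, fun j hj => by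
      obtain rfl : j = 0 := by omega
      simp [weightSum, rights, ups]⟩
  | succ k ih =>
    obtain ⟨t, ht⟩ := ih (by omega)
    obtain ⟨x, y, hx, hy, e⟩ := lpp_reflected N σ t (show k < N by omega)
    set b : Bool := decide (lpp σ (x + 1) y ≤ lpp σ x (y + 1)) with hb
    have hc : ∀ i < k, t i = Function.update t k b i := fun i hi => by simp [hi.ne]
    refine ⟨Function.update t k b, fun j hj => ?_⟩
    rcases Nat.le_succ_iff.1 hj with hj | rfl
    · have hc' : ∀ i < j, t i = Function.update t k b i := fun i hi => hc i (by omega)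
      rw [← weightSum_congr _ hc', ← rights_congr hc', ← ups_congr hc']
      exact ht j hj
    · have h := ht k le_rfl
      rw [weightSum, Finset.sum_range_succ, ← weightSum, rights, ups, ← weightSum_congr _ hc,
        ← rights_congr hc, ← ups_congr hc, ← stepPath_congr hc, Function.update_self]
      by_cases hle : lpp σ (x + 1) y ≤ lpp σ x (y + 1)
      · have e1 : N - (rights t k + 1) = x := by omega
        simp only [hb, hle, decide_true, Bool.not_true, Bool.toNat_true, Bool.toNat_false,
          add_zero, e1, hy]
        rw [max_eq_left hle] at e
        linarith
      · have e1 : N - (ups t k + 1) = y := by omega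
        simp only [hb, hle, decide_false, Bool.not_false, Bool.toNat_true, Bool.toNat_false,
          add_zero, e1, hx]
        rw [max_eq_right (not_le.1 hle).le] at e
        linarith

end Reflection

/-- The law of the vertex weights. -/
noncomputable def weightLaw : Measure (ℤ × ℤ → ℝ) := Measure.infinitePi fun _ => expMeasure 1

instance isProbabilityMeasure_weightLaw : IsProbabilityMeasure weightLaw := by
  unfold weightLaw; infer_instance

lemma measurePreserving_reflectedWeight (ρ : Set.Ioo (0 : ℝ) 1) (N : ℕ) :
    MeasurePreserving (reflectedWeight N) (statMeasure ρ) weightLaw := by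
  have hinj : Function.Injective
      (fun v : ℤ × ℤ => (.inr (.inr ((N : ℤ) - v.1, (N : ℤ) - v.2)) : Site)) := by
    rintro ⟨a, b⟩ ⟨c, d⟩ h
    simp only [Sum.inr.injEq, Prod.mk.injEq] at h ⊢
    omega
  refine ⟨measurable_pi_lambda _ fun v => measurable_pi_apply _, ?_⟩
  exact Measure.map_infinitePi_infinitePi_of_inj hinj

/-- Step sequences with finitely many steps to the right; they realise all finite paths. -/
def finSteps (F : Finset ℕ) (i : ℕ) : Bool := decide (i ∈ F)

lemma exists_finSteps (s : ℕ → Bool) (N : ℕ) : ∃ F, ∀ i < N, s i = finSteps F i :=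
  ⟨(Finset.range N).filter fun i => s i = true, fun i hi => by
    simp only [finSteps, Finset.mem_filter, Finset.mem_range, hi, true_and]; simp⟩

/-- A condition on finitely many steps has only countably many instances to check. -/
lemma measurableSet_exists_steps {X : Type*} [MeasurableSpace X] {p : (ℕ → Bool) → X → Prop} (N : ℕ)
    (hp : ∀ s t x, (∀ i < N, s i = t i) → p s x → p t x) (hm : ∀ s, MeasurableSet {x | p s x}) :
    MeasurableSet {x | ∃ s, p s x} := by
  have e : {x | ∃ s, p s x} = ⋃ F : Finset ℕ, {x | p (finSteps F) x} := by
    ext x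
    simp only [Set.mem_ofPred_eq, Set.mem_iUnion]
    constructor
    · rintro ⟨s, hs⟩
      obtain ⟨F, hF⟩ := exists_finSteps s N
      exact ⟨F, hp s _ x hF hs⟩
    · rintro ⟨F, hF⟩
      exact ⟨_, hF⟩
  rw [e]
  exact MeasurableSet.iUnion fun F => hm _

@[fun_prop]
lemma measurable_weightSum (s : ℕ → Bool) (k : ℕ) : Measurable fun τ => weightSum τ s k := by
  unfold weightSum; fun_prop

lemma measurableSet_isMaximal (s : ℕ → Bool) (N : ℕ) : MeasurableSet {τ | IsMaximal τ s N} := by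
  have e : {τ | IsMaximal τ s N}
      = {τ | ∃ t, stepPath t N = stepPath s N ∧ weightSum τ s N < weightSum τ t N}ᶜ := by
    ext τ
    simp [IsMaximal]
  rw [e]
  refine (measurableSet_exists_steps N ?_ fun t => ?_).compl
  · rintro t u τ h ⟨h1, h2⟩
    exact ⟨(stepPath_congr h).symm.trans h1, by rwa [← weightSum_congr τ h]⟩
  · by_cases h : stepPath t N = stepPath s N
    · simpa [h] using measurableSet_lt (measurable_weightSum s N) (measurable_weightSum t N)
    · simp [h]

@[fun_prop]
lemma measurable_meanIncr (a b : ℕ) : Measurable fun r => meanIncr r a b := by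
  unfold meanIncr; fun_prop

lemma measurableSet_followsMean (s : ℕ → Bool) (N K : ℕ) :
    MeasurableSet {q : (ℤ × ℤ → ℝ) × ℝ | FollowsMean q.2 q.1 s N K} := by
  simp only [FollowsMean, Set.ofPred_forall]
  refine MeasurableSet.iInter fun k => MeasurableSet.iInter fun _ =>
    MeasurableSet.iInter fun _ => ?_
  have h1 : Measurable fun q : (ℤ × ℤ → ℝ) × ℝ => weightSum q.1 s k :=
    (measurable_weightSum s k).comp measurable_fst
  have h2 : Measurable fun q : (ℤ × ℤ → ℝ) × ℝ => meanIncr q.2 (rights s k) (ups s k) :=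
    (measurable_meanIncr _ _).comp measurable_snd
  exact measurableSet_le (h2.sub_const _) h1

/-- Steps of a maximal path of length `N` that follows the mean with parameter `r` from time `K` on
and visits `v` at time `j` (if `j ≤ N`). -/
def IsApproxGeodesic (r : ℝ) (τ : ℤ × ℤ → ℝ) (K j : ℕ) (v : ℤ × ℤ) (N : ℕ) (s : ℕ → Bool) : Prop :=
  IsMaximal τ s N ∧ FollowsMean r τ s N K ∧ (j ≤ N → stepPath s j = v)

lemma IsApproxGeodesic.congr {r : ℝ} {τ : ℤ × ℤ → ℝ} {K j : ℕ} {v : ℤ × ℤ} {N : ℕ}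
    {s t : ℕ → Bool} (hs : IsApproxGeodesic r τ K j v N s) (h : ∀ i < N, s i = t i) :
    IsApproxGeodesic r τ K j v N t :=
  ⟨hs.1.congr h, hs.2.1.congr h, fun hj => by
    rw [← stepPath_congr fun i hi => h i (by omega)]; exact hs.2.2 hj⟩

lemma IsApproxGeodesic.mono {r : ℝ} {τ : ℤ × ℤ → ℝ} {K j : ℕ} {v : ℤ × ℤ} {N m : ℕ}
    {s : ℕ → Bool} (hs : IsApproxGeodesic r τ K j v N s) (h : m ≤ N) :
    IsApproxGeodesic r τ K j v m s :=
  ⟨hs.1.mono h, hs.2.1.mono h, fun hj => hs.2.2 (hj.trans h)⟩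

lemma measurableSet_exists_isApproxGeodesic (K j : ℕ) (v : ℤ × ℤ) (N : ℕ) :
    MeasurableSet {q : (ℤ × ℤ → ℝ) × ℝ | ∃ s, IsApproxGeodesic q.2 q.1 K j v N s} := by
  refine measurableSet_exists_steps N (fun s t q h hs => hs.congr h) fun s => ?_
  exact (measurable_fst (measurableSet_isMaximal s N)).inter
    ((measurableSet_followsMean s N K).inter (MeasurableSet.const _))

/-- There are arbitrarily long maximal paths which follow the mean with parameter `r` and visit `v`
at time `j`. -/
def HasApproxGeodesics (r : ℝ) (τ : ℤ × ℤ → ℝ) (j : ℕ) (v : ℤ × ℤ) : Prop :=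
  ∃ K, ∀ N, ∃ s, IsApproxGeodesic r τ K j v N s

lemma measurableSet_hasApproxGeodesics (j : ℕ) (v : ℤ × ℤ) :
    MeasurableSet {q : (ℤ × ℤ → ℝ) × ℝ | HasApproxGeodesics q.2 q.1 j v} := by
  simp only [HasApproxGeodesics, Set.ofPred_exists, Set.ofPred_forall]
  refine MeasurableSet.iUnion fun K => MeasurableSet.iInter fun N => ?_
  simpa only [Set.ofPred_exists] using measurableSet_exists_isApproxGeodesic K j v N

section Probability

variable (ρ : Set.Ioo (0 : ℝ) 1)

/-- Some increment over `k` steps of the stationary model, backwards from `(N, N)`, is far from its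
mean. -/
def farFromMean (N k : ℕ) : Set (Site → ℝ) :=
  ⋃ a ∈ Finset.range (k + 1), {σ | dev k ≤
    |lpp σ (N - a + a) (N - (k - a) + (k - a)) - lpp σ (N - a) (N - (k - a))
      - meanIncr ρ a (k - a)|}

lemma abs_lt_of_notMem_farFromMean {N k : ℕ} {σ : Site → ℝ} (h : σ ∉ farFromMean ρ N k) (hk : k ≤ N)
    (s : ℕ → Bool) :
    |lpp σ N N - lpp σ (N - rights s k) (N - ups s k) - meanIncr ρ (rights s k) (ups s k)|
      < dev k := by
  have h1 := rights_add_ups s k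
  by_contra hcon
  refine h ?_
  simp only [farFromMean, Set.mem_iUnion, Finset.mem_range]
  refine ⟨rights s k, by omega, ?_⟩
  rw [Set.mem_ofPred_eq, show k - rights s k = ups s k by omega,
    show N - rights s k + rights s k = N by omega, show N - ups s k + ups s k = N by omega]
  exact not_lt.1 hcon

lemma measureReal_farFromMean_le (N : ℕ) {k : ℕ} (hk : 0 < k) :
    (statMeasure ρ).real (farFromMean ρ N k) ≤ 2 * tailConst ρ * ((k : ℝ) ^ 2)⁻¹ := by
  have hC : 0 ≤ tailConst ρ := by unfold tailConst; positivity
  have hk1 : (1 : ℝ) ≤ k := by exact_mod_cast hk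
  have h := measureReal_biUnion_finset_le (μ := statMeasure ρ) (Finset.range (k + 1))
    fun a => {σ | dev k ≤
    |lpp σ (N - a + a) (N - (k - a) + (k - a)) - lpp σ (N - a) (N - (k - a))
      - meanIncr ρ a (k - a)|}
  have h2 := h.trans (Finset.sum_le_sum fun a ha =>
    measure_dev_le_abs_lpp ρ (N - a) (N - (k - a)) hk
    (show a + (k - a) = k by have := Finset.mem_range.1 ha; omega))
  refine h2.trans ?_
  rw [Finset.sum_const, Finset.card_range, nsmul_eq_mul, Nat.cast_add, Nat.cast_one]
  have e : ((k : ℝ) + 1) * (tailConst ρ / (k : ℝ) ^ 3) ≤ (2 * k) * (tailConst ρ / (k : ℝ) ^ 3) := by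
    gcongr; linarith
  refine e.trans (le_of_eq ?_)
  field_simp

/-- The bound is uniform in the length `N` of the paths. -/
lemma weightLaw_exists_le (N K : ℕ) :
    1 - 4 * tailConst ρ / (K + 1)
      ≤ weightLaw.real {τ | ∃ s, IsApproxGeodesic ρ τ K 0 0 N s} := by
  have hC : 0 ≤ tailConst ρ := by unfold tailConst; positivity
  have hm : MeasurableSet {τ | ∃ s, IsApproxGeodesic ρ τ K 0 0 N s} :=
    (measurable_id.prodMk measurable_const : Measurable fun τ : ℤ × ℤ → ℝ => (τ, (ρ : ℝ)))
      (measurableSet_exists_isApproxGeodesic K 0 0 N)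
  have hp := measurePreserving_reflectedWeight ρ N
  rw [← hp.measureReal_preimage hm.nullMeasurableSet]
  set B : Set (Site → ℝ) := ⋃ k ∈ Finset.Ioo K (N + 1), farFromMean ρ N k with hB
  have hB1 : (statMeasure ρ).real B ≤ 4 * tailConst ρ / (K + 1) := by
    refine (measureReal_biUnion_finset_le _ _).trans ((Finset.sum_le_sum fun k hk =>
      measureReal_farFromMean_le ρ N (Nat.zero_lt_of_lt (Finset.mem_Ioo.1 hk).1)).trans ?_)
    rw [← Finset.mul_sum]
    have := mul_le_mul_of_nonneg_left (sum_Ioo_inv_sq_le (α := ℝ) K (N + 1))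
      (show 0 ≤ 2 * tailConst ρ by positivity)
    refine this.trans (le_of_eq ?_)
    ring
  have hsub : Bᶜ ⊆ reflectedWeight N ⁻¹' {τ | ∃ s, IsApproxGeodesic ρ τ K 0 0 N s} := by
    intro σ hσ
    obtain ⟨s, hs⟩ := exists_weightSum_reflected_eq N σ le_rfl
    refine ⟨s, fun t ht => ?_, fun k hk hK => ?_, fun _ => rfl⟩
    · have h1 := weightSum_reflected_le N σ t le_rfl
      have h2 := stepPath_eq_iff.1 ht
      have h3 := rights_add_ups s N
      have h4 := rights_add_ups t N
      rw [hs N le_rfl, ← h2, show ups s N = ups t N by omega]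
      exact h1
    · have h1 : σ ∉ farFromMean ρ N k := fun h => hσ <| by
        simp only [hB, Set.mem_iUnion, Finset.mem_Ioo]
        exact ⟨k, ⟨hK, by omega⟩, h⟩
      rw [hs k hk]
      linarith [(abs_lt.1 (abs_lt_of_notMem_farFromMean ρ h1 hk s)).1]
  have h1 : 1 ≤ (statMeasure ρ).real B + (statMeasure ρ).real Bᶜ := by
    have := measureReal_union_le (μ := statMeasure ρ) B Bᶜ
    rwa [Set.union_compl_self, probReal_univ] at this
  have h2 := measureReal_mono hsub (measure_ne_top (statMeasure ρ) _)
  linarith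

/-- Almost surely there are arbitrarily long maximal paths which follow the mean. -/
lemma ae_hasApproxGeodesics : ∀ᵐ τ ∂weightLaw, HasApproxGeodesics ρ τ 0 0 := by
  have hm : ∀ K N, MeasurableSet {τ | ∃ s, IsApproxGeodesic ρ τ K 0 0 N s} := fun K N =>
    (measurable_id.prodMk measurable_const : Measurable fun τ : ℤ × ℤ → ℝ => (τ, (ρ : ℝ)))
      (measurableSet_exists_isApproxGeodesic K 0 0 N)
  have hanti : ∀ K, Antitone fun N => {τ | ∃ s, IsApproxGeodesic ρ τ K 0 0 N s} :=
    fun K m N hmN τ ⟨s, hs⟩ => ⟨s, hs.mono hmN⟩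
  have h1 : ∀ K : ℕ, 1 - 4 * tailConst ρ / (K + 1)
      ≤ weightLaw.real (⋂ N, {τ | ∃ s, IsApproxGeodesic ρ τ K 0 0 N s}) := by
    intro K
    have h := tendsto_measure_iInter_atTop (μ := weightLaw) (fun N => (hm K N).nullMeasurableSet)
      (hanti K) ⟨0, measure_ne_top _ _⟩
    have h' := (ENNReal.tendsto_toReal (measure_ne_top weightLaw _)).comp h
    exact ge_of_tendsto' h' fun N => weightLaw_exists_le ρ N K
  have h2 : 1 ≤ weightLaw.real {τ | HasApproxGeodesics ρ τ 0 0} := by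
    have h3 : Tendsto (fun K : ℕ => 1 - 4 * tailConst ρ / ((K : ℝ) + 1)) atTop (𝓝 (1 - 0)) := by
      refine tendsto_const_nhds.sub ?_
      have := (tendsto_one_div_add_atTop_nhds_zero_nat (𝕜 := ℝ)).const_mul (4 * tailConst ρ)
      simpa [div_eq_mul_inv] using this
    rw [sub_zero] at h3
    refine le_of_tendsto' h3 fun K => (h1 K).trans (measureReal_mono ?_ (measure_ne_top _ _))
    intro τ hτ
    exact ⟨K, fun N => Set.mem_iInter.1 hτ N⟩
  have hmA : MeasurableSet {τ | HasApproxGeodesics ρ τ 0 0} :=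
    (measurable_id.prodMk measurable_const : Measurable fun τ : ℤ × ℤ → ℝ => (τ, (ρ : ℝ)))
      (measurableSet_hasApproxGeodesics 0 0)
  rw [ae_iff]
  refine (prob_compl_eq_zero_iff hmA).2 (le_antisymm prob_le_one ?_)
  rw [← ENNReal.ofReal_one]
  exact ENNReal.ofReal_le_of_le_toReal h2

/-- Almost surely, no long path is much heavier than the mean increment of the stationary model. -/
lemma ae_eventually_weightSum_le : ∀ᵐ τ ∂weightLaw, ∀ᶠ k in atTop, ∀ s,
    weightSum τ s k ≤ meanIncr ρ (rights s k) (ups s k) + dev k := by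
  set B : ℕ → Set (ℤ × ℤ → ℝ) := fun k =>
    {τ | ∃ s, meanIncr ρ (rights s k) (ups s k) + dev k < weightSum τ s k} with hB
  have hm : ∀ k, MeasurableSet (B k) := fun k => by
    refine measurableSet_exists_steps k (fun s t τ h hs => ?_) fun s => ?_
    · rwa [← weightSum_congr τ h, ← rights_congr h, ← ups_congr h]
    · exact measurableSet_lt measurable_const (measurable_weightSum s k)
  have hle : ∀ k, 0 < k → weightLaw.real (B k) ≤ 2 * tailConst ρ * ((k : ℝ) ^ 2)⁻¹ := fun k hk => by
    rw [← (measurePreserving_reflectedWeight ρ k).measureReal_preimage (hm k).nullMeasurableSet]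
    refine (measureReal_mono ?_ (measure_ne_top _ _)).trans (measureReal_farFromMean_le ρ k hk)
    rintro σ ⟨s, hs⟩
    by_contra h
    have h1 := abs_lt.1 (abs_lt_of_notMem_farFromMean ρ h le_rfl s)
    linarith [weightSum_reflected_le k σ s le_rfl, h1.2]
  have hsum : Summable fun k => weightLaw.real (B k) := by
    have h2 : Summable fun k : ℕ => 2 * tailConst ρ * ((k : ℝ) ^ 2)⁻¹ :=
      (Real.summable_nat_pow_inv.2 one_lt_two).mul_left _
    rw [← summable_nat_add_iff 1] at h2 ⊢
    exact Summable.of_nonneg_of_le (fun k => measureReal_nonneg)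
      (fun k => hle (k + 1) k.succ_pos) h2
  have hfin : ∑' k, weightLaw (B k) ≠ ∞ := by
    have := hsum.tsum_ofReal_ne_top
    simpa [measureReal_def] using this
  filter_upwards [ae_eventually_notMem hfin] with τ hτ
  filter_upwards [hτ] with k hk s
  by_contra h
  exact hk ⟨s, not_le.1 h⟩

end Probability

/-! ### Compactness and the direction of the limiting geodesic -/

/-- Compactness of the space of step sequences. -/
lemma exists_forall_of_forall_exists {p : ℕ → (ℕ → Bool) → Prop}
    (hcongr : ∀ N s t, (∀ i < N, s i = t i) → p N s → p N t)
    (hmono : ∀ N s, p (N + 1) s → p N s) (h : ∀ N, ∃ s, p N s) : ∃ s, ∀ N, p N s := by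
  have hclosed : ∀ N, IsClosed {s | p N s} := fun N => by
    have e : {s | p N s} = (fun (s : ℕ → Bool) (i : Fin N) => s i) ⁻¹'
        {t | p N fun i => if h : i < N then t ⟨i, h⟩ else false} := by
      ext s
      have h1 : ∀ i < N, s i = if i < N then s i else false := fun i hi => by simp [hi]
      exact ⟨fun hs => hcongr N _ _ h1 hs, fun hs => hcongr N _ _ (fun i hi => (h1 i hi).symm) hs⟩
    rw [e]
    exact (isClosed_discrete _).preimage (by fun_prop)
  obtain ⟨s, hs⟩ := IsCompact.nonempty_iInter_of_sequence_nonempty_isCompact_isClosed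
    (fun N => {s | p N s}) (fun N s hs => hmono N s hs) h (hclosed 0).isCompact hclosed
  exact ⟨s, fun N => Set.mem_iInter.1 hs N⟩

/-- Arbitrarily long approximate geodesics have an infinite geodesic as a limit. -/
lemma HasApproxGeodesics.exists_steps {r : ℝ} {τ : ℤ × ℤ → ℝ} {j : ℕ} {v : ℤ × ℤ}
    (h : HasApproxGeodesics r τ j v) : ∃ s, (∀ N, IsMaximal τ s N) ∧ stepPath s j = v ∧
      ∃ K, ∀ k, K < k → meanIncr r (rights s k) (ups s k) - dev k ≤ weightSum τ s k := by
  obtain ⟨K, hK⟩ := h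
  obtain ⟨s, hs⟩ := exists_forall_of_forall_exists
    (p := fun N s => IsApproxGeodesic r τ K j v N s) (fun N s t h hs => hs.congr h)
    (fun N s hs => hs.mono N.le_succ) hK
  exact ⟨s, fun N => (hs N).1, (hs j).2.2 le_rfl, K, fun k hk => (hs k).2.1 k le_rfl hk⟩

lemma tendsto_dev_div : Tendsto (fun k : ℕ => dev k / k) atTop (𝓝 0) := by
  have h : Tendsto (fun k : ℕ => (√√(k : ℝ))⁻¹) atTop (𝓝 0) :=
    tendsto_inv_atTop_zero.comp (Real.tendsto_sqrt_atTop.comp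
      (Real.tendsto_sqrt_atTop.comp tendsto_natCast_atTop_atTop))
  refine h.congr' ?_
  filter_upwards [eventually_gt_atTop 0] with k hk
  have hk0 : (0 : ℝ) < k := by exact_mod_cast hk
  set q := √√(k : ℝ) with hq
  have hq2 : q ^ 2 = √(k : ℝ) := Real.sq_sqrt (Real.sqrt_nonneg _)
  have hq4 : q ^ 4 = k := by
    rw [show q ^ 4 = (q ^ 2) ^ 2 by ring, hq2, Real.sq_sqrt hk0.le]
  have hq0 : 0 < q := Real.sqrt_pos.2 (Real.sqrt_pos.2 hk0)
  rw [dev, ← hq, ← hq2, ← hq4]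
  field_simp

/-- A path whose weights follow the mean with parameter `r`, while they do not exceed the means with
other parameters, has an asymptotic proportion of steps to the right: the parameter `r` minimises
the mean increment in the direction of the path. -/
lemma tendsto_rights_div {r : ℝ} (h0 : 0 < r) (h1 : r < 1) {τ : ℤ × ℤ → ℝ} {s : ℕ → Bool}
    (hs : ∃ K, ∀ k, K < k → meanIncr r (rights s k) (ups s k) - dev k ≤ weightSum τ s k)
    (hq : ∀ q : ℚ, (0 : ℝ) < q → (q : ℝ) < 1 → ∀ᶠ k in atTop,
      weightSum τ s k ≤ meanIncr q (rights s k) (ups s k) + dev k) :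
    Tendsto (fun k => (rights s k : ℝ) / k) atTop (𝓝 (r ^ 2 / (r ^ 2 + (1 - r) ^ 2))) := by
  set g : ℝ → ℝ := fun q => r * q / (r * q + (1 - r) * (1 - q)) with hg
  have hr' : 0 < 1 - r := sub_pos.2 h1
  have hgr : g r = r ^ 2 / (r ^ 2 + (1 - r) ^ 2) := by simp only [hg]; ring
  have hgc : ContinuousAt g r := by
    refine ContinuousAt.div (by fun_prop) (by fun_prop) ?_
    positivity
  -- Comparing `r` with a parameter `q` bounds the proportion of steps to the right by `g q`, from
  -- above if `r < q` and from below if `q < r`; as `q` tends to `r`, so does `g q` to `g r`.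
  have key : ∀ q : ℚ, (0 : ℝ) < q → (q : ℝ) < 1 → ∀ᶠ k : ℕ in atTop,
      ((rights s k : ℝ) / k - g q) * (q - r) ≤
        2 * (r * q * ((1 - r) * (1 - q)) / (r * q + (1 - r) * (1 - q))) * (dev k / k) := by
    intro q hq0 hq1
    obtain ⟨K, hK⟩ := hs
    filter_upwards [hq q hq0 hq1, eventually_gt_atTop K, eventually_gt_atTop 0] with k hk1 hk2 hk3
    have hk0 : (0 : ℝ) < k := by exact_mod_cast hk3
    have h := (hK k hk2).trans hk1
    have hu : (ups s k : ℝ) = k - rights s k := by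
      have : ((rights s k + ups s k : ℕ) : ℝ) = k := by rw [rights_add_ups]
      push_cast at this; linarith
    rw [meanIncr, meanIncr, hu] at h
    have hq' : 0 < 1 - (q : ℝ) := sub_pos.2 hq1
    set R : ℝ := (rights s k : ℝ)
    set Q : ℝ := (q : ℝ)
    have hD : 0 < r * Q + (1 - r) * (1 - Q) := by positivity
    set c : ℝ := r * Q * ((1 - r) * (1 - Q)) / (r * Q + (1 - r) * (1 - Q)) with hc
    have hc0 : 0 < c := by positivity
    have e : (R / k - g Q) * (Q - r) = c / k * ((R / r + (k - R) / (1 - r))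
        - (R / Q + (k - R) / (1 - Q))) := by
      simp only [hg, hc]
      field_simp
      ring
    rw [e]
    have h5 : (R / r + (k - R) / (1 - r)) - (R / Q + (k - R) / (1 - Q)) ≤ 2 * dev k := by linarith
    have h6 : 0 ≤ c / k := by positivity
    refine (mul_le_mul_of_nonneg_left h5 h6).trans (le_of_eq ?_)
    ring
  have hlim : ∀ c : ℝ, Tendsto (fun k : ℕ => c * (dev k / k)) atTop (𝓝 0) := fun c => by
    simpa using tendsto_dev_div.const_mul c
  rw [← hgr]
  refine tendsto_order.2 ⟨fun c hc => ?_, fun c hc => ?_⟩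
  · obtain ⟨l, hl, hl'⟩ := exists_Ioc_subset_of_mem_nhds (hgc.eventually (lt_mem_nhds hc))
      ⟨0, h0⟩
    obtain ⟨q, hq1, hq2⟩ := exists_rat_btwn (max_lt hl h0)
    have hgq : c < g q := hl' ⟨(le_max_left _ _).trans_lt hq1, hq2.le⟩
    have hqr : (q : ℝ) - r < 0 := sub_neg.2 hq2
    have hneg : (0 : ℝ) < (c - g q) * (q - r) := mul_pos_of_neg_of_neg (by linarith) hqr
    filter_upwards [key q ((le_max_right _ _).trans_lt hq1) (hq2.trans h1),
      (hlim _).eventually (gt_mem_nhds hneg)] with k hk1 hk2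
    have := (mul_lt_mul_right_of_neg hqr).1 (hk1.trans_lt hk2)
    linarith
  · obtain ⟨u, hu, hu'⟩ := exists_Ico_subset_of_mem_nhds (hgc.eventually (gt_mem_nhds hc))
      ⟨1, h1⟩
    obtain ⟨q, hq1, hq2⟩ := exists_rat_btwn (lt_min hu h1)
    have hgq : g q < c := hu' ⟨hq1.le, hq2.trans_le (min_le_left _ _)⟩
    have hqr : 0 < (q : ℝ) - r := sub_pos.2 hq1
    have hpos : (0 : ℝ) < (c - g q) * (q - r) := mul_pos (by linarith) hqr
    filter_upwards [key q (h0.trans hq1) (hq2.trans_le (min_le_right _ _)),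
      (hlim _).eventually (gt_mem_nhds hpos)] with k hk1 hk2
    have := lt_of_mul_lt_mul_right (hk1.trans_lt hk2) hqr.le
    linarith

/-- The asymptotic proportion of steps to the right of a path with direction `α`. -/
noncomputable def dirSlope (α : ℝ) : ℝ := Real.cos α / (Real.cos α + Real.sin α)

/-- The parameter of the stationary model whose geodesics have direction `α`. -/
noncomputable def dirParam (α : ℝ) : ℝ := √(Real.cos α) / (√(Real.cos α) + √(Real.sin α))

section Direction

variable {α : ℝ}

lemma cos_pos_sin_pos (hα : α ∈ Set.Ioo 0 (Real.pi / 2)) : 0 < Real.cos α ∧ 0 < Real.sin α :=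
  ⟨Real.cos_pos_of_mem_Ioo ⟨by linarith [hα.1, Real.pi_pos], hα.2⟩,
    Real.sin_pos_of_pos_of_lt_pi hα.1 (by linarith [hα.2, Real.pi_pos])⟩

lemma dirParam_mem (hα : α ∈ Set.Ioo 0 (Real.pi / 2)) : dirParam α ∈ Set.Ioo (0 : ℝ) 1 := by
  obtain ⟨hc, hs⟩ := cos_pos_sin_pos hα
  have h1 := Real.sqrt_pos.2 hc
  have h2 := Real.sqrt_pos.2 hs
  refine ⟨by unfold dirParam; positivity, ?_⟩
  rw [dirParam, div_lt_one (by positivity)]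
  linarith

lemma dirParam_sq_div (hα : α ∈ Set.Ioo 0 (Real.pi / 2)) :
    dirParam α ^ 2 / (dirParam α ^ 2 + (1 - dirParam α) ^ 2) = dirSlope α := by
  obtain ⟨hc, hs⟩ := cos_pos_sin_pos hα
  have h1 := Real.sqrt_pos.2 hc
  have h2 := Real.sqrt_pos.2 hs
  have e : 1 - dirParam α = √(Real.sin α) / (√(Real.cos α) + √(Real.sin α)) := by
    rw [dirParam]; field_simp; ring
  rw [e, dirParam, dirSlope, div_pow, div_pow, Real.sq_sqrt hc.le, Real.sq_sqrt hs.le]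
  field_simp

/-- For an up-right path, having a direction in the open quadrant amounts to the convergence of the
proportion of steps to the right. -/
lemma hasDirection_iff (hα : α ∈ Set.Ioo 0 (Real.pi / 2)) {γ : ℕ → ℤ × ℤ} {c : ℤ}
    (hγ : ∀ k, (γ k).1 + (γ k).2 = k + c) :
    HasDirection γ α ↔ Tendsto (fun k : ℕ => ((γ k).1 : ℝ) / k) atTop (𝓝 (dirSlope α)) := by
  obtain ⟨hc, hs⟩ := cos_pos_sin_pos hα
  have hsum : ∀ k, ((γ k).1 : ℝ) + (γ k).2 = k + c := fun k => by exact_mod_cast hγ k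
  have hck : Tendsto (fun k : ℕ => ((k : ℝ) + c) / k) atTop (𝓝 1) := by
    have h := (tendsto_const_div_atTop_nhds_zero_nat (c : ℝ)).const_add 1
    rw [add_zero] at h
    refine h.congr' ?_
    filter_upwards [eventually_gt_atTop 0] with k hk
    have hk0 : (0 : ℝ) < k := by exact_mod_cast hk
    field_simp
  constructor
  · rintro ⟨h1, h2⟩
    have h3 := (h1.div (h1.add h2) (by positivity)).mul hck
    rw [mul_one] at h3
    refine h3.congr' ?_
    have hpos := (h1.add h2).eventually
      (lt_mem_nhds (show 0 < Real.cos α + Real.sin α by positivity))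
    filter_upwards [hpos] with k hk
    rw [← add_div] at hk
    have hn : euclNorm (γ k) ≠ 0 := fun h => by simp [h] at hk
    have hk' : ((γ k).1 : ℝ) + (γ k).2 ≠ 0 := fun h => by simp [h] at hk
    simp only [Pi.div_apply, ← hsum]
    field_simp
  · intro h1
    have h2 : Tendsto (fun k : ℕ => ((γ k).2 : ℝ) / k) atTop (𝓝 (1 - dirSlope α)) := by
      refine (hck.sub h1).congr fun k => ?_
      rw [← hsum, ← sub_div, add_sub_cancel_left]
    have e2 : 1 - dirSlope α = Real.sin α / (Real.cos α + Real.sin α) := by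
      rw [dirSlope]; field_simp; ring
    have hcs : 0 < Real.cos α + Real.sin α := by positivity
    have h3 : Tendsto (fun k : ℕ => euclNorm (γ k) / k) atTop
        (𝓝 (1 / (Real.cos α + Real.sin α))) := by
      have h4 := ((h1.pow 2).add (h2.pow 2)).sqrt
      have e3 : √(dirSlope α ^ 2 + (1 - dirSlope α) ^ 2) = 1 / (Real.cos α + Real.sin α) := by
        rw [Real.sqrt_eq_iff_mul_self_eq (by positivity) (by positivity), e2, dirSlope]
        have := Real.sin_sq_add_cos_sq α
        field_simp
        linarith
      rw [e3] at h4
      refine h4.congr fun k => ?_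
      rw [div_pow, div_pow, ← add_div, Real.sqrt_div' _ (sq_nonneg _),
        Real.sqrt_sq (Nat.cast_nonneg k), euclNorm]
    have hne : 1 / (Real.cos α + Real.sin α) ≠ 0 := by positivity
    constructor
    · have h5 := h1.div h3 hne
      have e4 : dirSlope α / (1 / (Real.cos α + Real.sin α)) = Real.cos α := by
        rw [dirSlope]; field_simp
      rw [e4] at h5
      refine h5.congr' ?_
      filter_upwards [eventually_gt_atTop 0] with k hk
      have hk0 : (k : ℝ) ≠ 0 := by exact_mod_cast hk.ne'
      exact div_div_div_cancel_right₀ hk0 _ _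
    · have h5 := h2.div h3 hne
      have e4 : (1 - dirSlope α) / (1 / (Real.cos α + Real.sin α)) = Real.sin α := by
        rw [e2]; field_simp
      rw [e4] at h5
      refine h5.congr' ?_
      filter_upwards [eventually_gt_atTop 0] with k hk
      have hk0 : (k : ℝ) ≠ 0 := by exact_mod_cast hk.ne'
      exact div_div_div_cancel_right₀ hk0 _ _

end Direction

/-! ### Uniqueness of the geodesic in a given direction -/

/-- The weights seen from `u`. -/
def shiftWeight (τ : ℤ × ℤ → ℝ) (u v : ℤ × ℤ) : ℝ := τ (v + u)

lemma shiftWeight_shiftWeight (τ : ℤ × ℤ → ℝ) (u v : ℤ × ℤ) :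
    shiftWeight (shiftWeight τ u) v = shiftWeight τ (v + u) := by
  funext w; simp [shiftWeight, add_assoc]

lemma rights_add (s : ℕ → Bool) (i k : ℕ) :
    rights s (i + k) = rights s i + rights (fun j => s (i + j)) k := by
  induction k with
  | zero => rfl
  | succ k ih => rw [← add_assoc, rights, rights, ih]; ring

lemma ups_add (s : ℕ → Bool) (i k : ℕ) :
    ups s (i + k) = ups s i + ups (fun j => s (i + j)) k := by
  have h1 := rights_add_ups s (i + k)
  have h2 := rights_add_ups s i
  have h3 := rights_add_ups (fun j => s (i + j)) k
  have h4 := rights_add s i k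
  omega

lemma stepPath_add (s : ℕ → Bool) (i k : ℕ) :
    stepPath s (i + k) = stepPath (fun j => s (i + j)) k + stepPath s i := by
  simp only [stepPath, rights_add, ups_add, Prod.mk_add_mk, Nat.cast_add, add_comm]

lemma weightSum_add (τ : ℤ × ℤ → ℝ) (s : ℕ → Bool) (i k : ℕ) :
    weightSum τ s (i + k)
      = weightSum τ s i + weightSum (shiftWeight τ (stepPath s i)) (fun j => s (i + j)) k := by
  simp only [weightSum, Finset.sum_range_add, shiftWeight, stepPath_add]

lemma stepPath_zero (s : ℕ → Bool) : stepPath s 0 = 0 := rfl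

lemma isStep_stepPath (s : ℕ → Bool) (k : ℕ) : IsStep (stepPath s k) (stepPath s (k + 1)) := by
  unfold IsStep stepPath
  rw [rights, ups]
  cases s k <;> simp

/-- Every up-right path is a translate of the path with some sequence of steps. -/
lemma exists_stepPath {p : ℕ → ℤ × ℤ} {m : ℕ} (h : ∀ k < m, IsStep (p k) (p (k + 1))) :
    ∃ s, ∀ k ≤ m, p k = stepPath s k + p 0 := by
  refine ⟨fun k => decide (p (k + 1) = p k + (1, 0)), fun k hk => ?_⟩
  induction k with
  | zero => simp [stepPath_zero]
  | succ k ih =>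
    have e := ih (by omega)
    by_cases hr : p (k + 1) = p k + (1, 0)
    · rw [hr, e]
      simp only [stepPath, rights, ups, hr, decide_true, Bool.toNat_true, Bool.not_true,
        Bool.toNat_false]
      ext
      · simp; ring
      · simp
    · have hu := (h k (by omega)).resolve_left hr
      rw [hu, e]
      simp only [stepPath, rights, ups, hr, decide_false, Bool.toNat_true, Bool.not_false,
        Bool.toNat_false]
      ext
      · simp
      · simp; ring

lemma exists_stepPath_infinite {p : ℕ → ℤ × ℤ} (h : ∀ k, IsStep (p k) (p (k + 1))) :
    ∃ s, ∀ k, p k = stepPath s k + p 0 := by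
  have h1 := fun m => exists_stepPath (p := p) (m := m) fun k _ => h k
  obtain ⟨s, hs⟩ := exists_forall_of_forall_exists
    (p := fun m s => ∀ k ≤ m, p k = stepPath s k + p 0)
    (fun N s t hst hs k hk => by
      rw [hs k hk, stepPath_congr fun i hi => hst i (by omega)])
    (fun N s hs k hk => hs k (by omega)) h1
  exact ⟨s, fun k => hs k k le_rfl⟩

/-- The passage time omits both end points and the weight sum only the last one, which makes no
difference when paths with common end points are compared. -/
lemma add_passageTime {τ : ℤ × ℤ → ℝ} {p : ℕ → ℤ × ℤ} {m : ℕ} (hm : 0 < m) {s : ℕ → Bool}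
    {u : ℤ × ℤ} (hp : ∀ k ≤ m, p k = stepPath s k + u) :
    τ u + passageTime τ p m = weightSum (shiftWeight τ u) s m := by
  obtain ⟨n, rfl⟩ := Nat.exists_eq_add_of_le' hm
  rw [weightSum, Finset.sum_range_succ', passageTime, add_comm]
  congr 1
  · rw [Finset.range_eq_Ico, Finset.sum_Ico_add' (fun i => shiftWeight τ u (stepPath s i)) 0 n 1]
    refine Finset.sum_congr (by ext; simp; omega) fun k hk => ?_
    rw [shiftWeight, hp k (by simp at hk; omega)]
  · simp [shiftWeight, stepPath_zero]

lemma passageTime_zero (τ : ℤ × ℤ → ℝ) (p : ℕ → ℤ × ℤ) : passageTime τ p 0 = 0 := by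
  simp [passageTime]

lemma isGeodesic_iff {τ : ℤ × ℤ → ℝ} {p : ℕ → ℤ × ℤ} {m : ℕ} {s : ℕ → Bool} {u : ℤ × ℤ}
    (hp : ∀ k ≤ m, p k = stepPath s k + u) :
    IsGeodesic τ p m u (p m) ↔ IsMaximal (shiftWeight τ u) s m := by
  constructor
  · rintro ⟨-, h⟩ t ht
    rcases Nat.eq_zero_or_pos m with rfl | hm
    · simp [weightSum]
    have h1 := h (fun k => stepPath t k + u) m ⟨by simp [stepPath_zero],
      by simp only [hp m le_rfl, ht],
      fun k _ => by
        rcases isStep_stepPath t k with h | h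
        · exact Or.inl (by simp only [h]; abel)
        · exact Or.inr (by simp only [h]; abel)⟩
    rw [← add_passageTime hm hp, ← add_passageTime hm (p := fun k => stepPath t k + u)
      fun k _ => rfl]
    linarith
  · intro h
    refine ⟨⟨by rw [hp 0 (Nat.zero_le _), stepPath_zero, zero_add], rfl, fun k hk => ?_⟩, ?_⟩
    · rw [hp k hk.le, hp (k + 1) hk]
      rcases isStep_stepPath s k with h | h
      · exact Or.inl (by simp only [h]; abel)
      · exact Or.inr (by simp only [h]; abel)
    · rintro q m' ⟨hq0, hqm, hq⟩
      obtain ⟨t, ht⟩ := exists_stepPath hq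
      rw [hq0] at ht
      have e : stepPath t m' = stepPath s m := by
        have := ht m' le_rfl
        rw [hqm, hp m le_rfl] at this
        exact (add_right_cancel this).symm
      obtain rfl : m' = m := by
        have h1 := rights_add_ups t m'
        have h2 := rights_add_ups s m
        simp only [stepPath, Prod.mk.injEq, Nat.cast_inj] at e
        omega
      rcases Nat.eq_zero_or_pos m' with rfl | hm
      · simp [passageTime_zero]
      have := h t e
      rw [← add_passageTime hm hp, ← add_passageTime hm ht] at this
      linarith

/-- A final segment of a maximal path is maximal. -/
lemma IsMaximal.tail {τ : ℤ × ℤ → ℝ} {s : ℕ → Bool} {i m : ℕ} (h : IsMaximal τ s (i + m)) :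
    IsMaximal (shiftWeight τ (stepPath s i)) (fun j => s (i + j)) m := by
  intro t ht
  set w : ℕ → Bool := splice s (fun k => t (k - i)) i with hw
  have h1 : stepPath w i = stepPath s i := stepPath_splice_of_le _ _ le_rfl
  have h2 : (fun j => w (i + j)) = t := by
    funext j; simp [hw, splice]
  have h3 : weightSum τ w i = weightSum τ s i :=
    weightSum_congr τ fun j hj => by simp [hw, splice, hj]
  have h4 := h w (by rw [stepPath_add, stepPath_add, h1, h2, ht])
  rw [weightSum_add, weightSum_add, h1, h2, h3] at h4
  linarith

lemma isSemiInfiniteGeodesic_iff {τ : ℤ × ℤ → ℝ} {u : ℤ × ℤ} {γ : ℕ → ℤ × ℤ} {s : ℕ → Bool}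
    (hγ : ∀ k, γ k = stepPath s k + u) :
    IsSemiInfiniteGeodesic τ u γ ↔ ∀ N, IsMaximal (shiftWeight τ u) s N := by
  constructor
  · rintro ⟨h0, -, h⟩ N
    have h1 := h 0 N
    simp only [zero_add, h0] at h1
    exact (isGeodesic_iff fun k _ => hγ k).1 h1
  · intro h
    refine ⟨by rw [hγ, stepPath_zero, zero_add], fun k => ?_, fun i m => ?_⟩
    · rw [hγ k, hγ (k + 1)]
      rcases isStep_stepPath s k with h | h
      · exact Or.inl (by simp only [h]; abel)
      · exact Or.inr (by simp only [h]; abel)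
    · refine (isGeodesic_iff (s := fun j => s (i + j)) (p := fun k => γ (i + k)) fun k _ => ?_).2 ?_
      · rw [hγ, hγ, stepPath_add, add_assoc]
      · rw [hγ i, ← shiftWeight_shiftWeight]
        exact (h (i + m)).tail

/-- Paths from the origin with different first steps but a common end point never have the same
weight. -/
def NoTies (τ : ℤ × ℤ → ℝ) : Prop :=
  ∀ s t N, s 0 = true → t 0 = false → stepPath s N = stepPath t N → 0 < N →
    weightSum τ s N ≠ weightSum τ t N

/-- The fewest steps to the right among the maximal paths of length `n` from the origin that start
with a step to the right. The value `n` is added to the candidates so that the set is visibly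
nonempty and the infimum is attained. -/
noncomputable def lowerEdge (τ : ℤ × ℤ → ℝ) (n : ℕ) : ℕ :=
  sInf ({m | ∃ s, s 0 = true ∧ IsMaximal τ s n ∧ rights s n = m} ∪ {n})

/-- The asymptotic slope of the interface between the maximal paths that start with a step to the
right and those that start with a step up. -/
noncomputable def interfaceSlope (τ : ℤ × ℤ → ℝ) : ℝ :=
  liminf (fun n : ℕ => (lowerEdge τ n : ℝ) / n) atTop

/-- Planarity: maximal paths with different first steps never meet again. -/
lemma rights_lt_of_first_steps {τ : ℤ × ℤ → ℝ} (hτ : NoTies τ) {s t : ℕ → Bool} (hs0 : s 0 = true)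
    (ht0 : t 0 = false) {n : ℕ} (hs : IsMaximal τ s n) (ht : IsMaximal τ t n) (hn : 0 < n) :
    rights t n < rights s n := by
  induction n, hn using Nat.le_induction with
  | base => simp [rights, hs0, ht0]
  | succ n hn ih =>
    have h := ih (hs.mono n.le_succ) (ht.mono n.le_succ)
    -- The paths cannot cross without meeting, and where they meet their weights are equal.
    have hne : rights s (n + 1) ≠ rights t (n + 1) := fun h1 => by
      have e := stepPath_eq_iff.2 h1
      exact hτ s t (n + 1) hs0 ht0 e n.succ_pos (le_antisymm (ht s e) (hs t e.symm))
    have h3 : rights s (n + 1) = rights s n + (s n).toNat := rfl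
    have h4 : rights t (n + 1) = rights t n + (t n).toNat := rfl
    have h5 := Bool.toNat_le (t n)
    omega

/-- If two infinite geodesics from the origin with different first steps have the same direction,
then this is the direction of the interface. -/
lemma eq_interfaceSlope {τ : ℤ × ℤ → ℝ} (hτ : NoTies τ) {s t : ℕ → Bool} (hs0 : s 0 = true)
    (ht0 : t 0 = false) (hs : ∀ n, IsMaximal τ s n) (ht : ∀ n, IsMaximal τ t n) {p : ℝ}
    (hsp : Tendsto (fun k : ℕ => (rights s k : ℝ) / k) atTop (𝓝 p))
    (htp : Tendsto (fun k : ℕ => (rights t k : ℝ) / k) atTop (𝓝 p)) : p = interfaceSlope τ := by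
  have h1 : ∀ n, lowerEdge τ n ≤ rights s n := fun n =>
    Nat.sInf_le (Or.inl ⟨s, hs0, hs n, rfl⟩)
  have h2 : ∀ n, rights t n ≤ lowerEdge τ n := fun n => by
    rcases Nat.eq_zero_or_pos n with rfl | hn
    · simp [rights]
    refine le_csInf ⟨n, Or.inr rfl⟩ ?_
    rintro m (⟨w, hw0, hw, rfl⟩ | rfl)
    · exact (rights_lt_of_first_steps hτ hw0 ht0 hw (ht n) hn).le
    · have := rights_add_ups t m
      omega
  refine (Tendsto.liminf_eq ?_).symm
  refine tendsto_of_tendsto_of_tendsto_of_le_of_le htp hsp (fun n => ?_) fun n => ?_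
  · exact div_le_div_of_nonneg_right (Nat.cast_le.2 (h2 n)) (Nat.cast_nonneg n)
  · exact div_le_div_of_nonneg_right (Nat.cast_le.2 (h1 n)) (Nat.cast_nonneg n)

lemma measurable_lowerEdge (n : ℕ) : Measurable fun τ => lowerEdge τ n := by
  refine measurable_of_Iio fun m => ?_
  have e : (fun τ => lowerEdge τ n) ⁻¹' Set.Iio m
      = {τ | ∃ s, s 0 = true ∧ IsMaximal τ s n ∧ rights s n < m} ∪ {τ | n < m} := by
    ext τ
    have hne : ({m | ∃ s, s 0 = true ∧ IsMaximal τ s n ∧ rights s n = m} ∪ {n} : Set ℕ).Nonempty :=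
      ⟨n, Or.inr rfl⟩
    constructor
    · intro h
      rcases Nat.sInf_mem hne with ⟨s, h1, h2, h3⟩ | h3
      · exact Or.inl ⟨s, h1, h2, h3.trans_lt h⟩
      · exact Or.inr (lt_of_eq_of_lt (Set.mem_singleton_iff.1 h3).symm h)
    · rintro (⟨s, h1, h2, h3⟩ | h)
      · exact (Nat.sInf_le (Or.inl ⟨s, h1, h2, rfl⟩)).trans_lt h3
      · exact (Nat.sInf_le (Or.inr rfl)).trans_lt h
  rw [e]
  refine (measurableSet_exists_steps (n + 1) ?_ fun s => ?_).union (MeasurableSet.const _)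
  · rintro s t τ h ⟨h1, h2, h3⟩
    exact ⟨by rw [← h 0 n.succ_pos, h1], h2.congr fun i hi => h i (by omega),
      by rwa [← rights_congr fun i hi => h i (by omega)]⟩
  · exact (MeasurableSet.const _).inter
      ((measurableSet_isMaximal s n).inter (MeasurableSet.const _))

lemma measurable_interfaceSlope : Measurable interfaceSlope := by
  unfold interfaceSlope
  refine Measurable.liminf fun n => ?_
  exact (measurable_from_nat.comp (measurable_lowerEdge n)).div_const _

/-- Two different infinite geodesics with the same direction first separate at some vertex, and
their direction is that of the interface from this vertex. -/
lemma steps_eq_of_tendsto {τ : ℤ × ℤ → ℝ} {p : ℝ} (hτ : ∀ v, NoTies (shiftWeight τ v))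
    (hp : ∀ v, p ≠ interfaceSlope (shiftWeight τ v)) {s t : ℕ → Bool}
    (hs : ∀ n, IsMaximal τ s n) (ht : ∀ n, IsMaximal τ t n)
    (hsp : Tendsto (fun k : ℕ => (rights s k : ℝ) / k) atTop (𝓝 p))
    (htp : Tendsto (fun k : ℕ => (rights t k : ℝ) / k) atTop (𝓝 p)) : s = t := by
  have key : ∀ s t : ℕ → Bool, (∀ n, IsMaximal τ s n) → (∀ n, IsMaximal τ t n) →
      Tendsto (fun k : ℕ => (rights s k : ℝ) / k) atTop (𝓝 p) →
      Tendsto (fun k : ℕ => (rights t k : ℝ) / k) atTop (𝓝 p) →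
      ∀ i, (∀ j < i, s j = t j) → ¬ (s i = true ∧ t i = false) := by
    rintro s t hs ht hsp htp i hi ⟨h1, h2⟩
    have hst := stepPath_congr hi
    have htail : ∀ w : ℕ → Bool, Tendsto (fun k : ℕ => (rights w k : ℝ) / k) atTop (𝓝 p) →
        Tendsto (fun k : ℕ => (rights (fun j => w (i + j)) k : ℝ) / k) atTop (𝓝 p) := by
      intro w hw
      have h3 := hw.comp (tendsto_add_atTop_nat i)
      have h4 : Tendsto (fun k : ℕ => ((k + i : ℕ) : ℝ) / k) atTop (𝓝 1) := by
        have h := (tendsto_const_div_atTop_nhds_zero_nat (i : ℝ)).const_add 1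
        rw [add_zero] at h
        refine h.congr' ?_
        filter_upwards [eventually_gt_atTop 0] with k hk
        have hk0 : (0 : ℝ) < k := by exact_mod_cast hk
        push_cast
        field_simp
      have h5 := (h3.mul h4).sub (tendsto_const_div_atTop_nhds_zero_nat (rights w i : ℝ))
      rw [mul_one, sub_zero] at h5
      refine h5.congr' ?_
      filter_upwards [eventually_gt_atTop 0] with k hk
      have hk0 : (k : ℝ) ≠ 0 := by exact_mod_cast hk.ne'
      have hk1 : ((k + i : ℕ) : ℝ) ≠ 0 := by positivity
      have e := rights_add w i k
      rw [add_comm] at e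
      rw [Function.comp, div_mul_div_cancel₀ hk1, ← sub_div, e]
      push_cast
      ring
    exact hp _ (eq_interfaceSlope (hτ (stepPath s i)) (s := fun j => s (i + j))
      (t := fun j => t (i + j)) h1 h2 (fun n => (hs (i + n)).tail)
      (fun n => by rw [hst]; exact (ht (i + n)).tail) (htail s hsp) (htail t htp))
  funext i
  induction i using Nat.strong_induction_on with
  | _ i ih =>
    have h1 := key s t hs ht hsp htp i ih
    have h2 := key t s ht hs htp hsp i fun j hj => (ih j hj).symm
    revert h1 h2
    cases s i <;> cases t i <;> simp

/-! ### Almost sure regularity and the expected number of cars -/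

lemma measurable_shiftWeight (u : ℤ × ℤ) :
    Measurable fun τ : ℤ × ℤ → ℝ => shiftWeight τ u :=
  measurable_pi_lambda _ fun _ => measurable_pi_apply _

lemma measurePreserving_shiftWeight (u : ℤ × ℤ) :
    MeasurePreserving (fun τ => shiftWeight τ u) weightLaw weightLaw :=
  ⟨measurable_shiftWeight u,
    Measure.map_infinitePi_infinitePi_of_inj (f := fun v => v + u) (add_left_injective u)⟩

lemma measure_eq_eq_zero_of_indepFun {Ω : Type*} [MeasurableSpace Ω] {μ : Measure Ω}
    [IsProbabilityMeasure μ] {X Y : Ω → ℝ} (hX : Measurable X) (hY : Measurable Y)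
    (h : IndepFun X Y μ) [NullSingletonClass (μ.map X)] : μ {ω | X ω = Y ω} = 0 := by
  have hd : MeasurableSet {q : ℝ × ℝ | q.2 = q.1} :=
    measurableSet_eq_fun measurable_snd measurable_fst
  have h1 := (indepFun_iff_map_prod_eq_prod_map_map hY.aemeasurable hX.aemeasurable).1 h.symm
  have : IsProbabilityMeasure (μ.map X) := Measure.isProbabilityMeasure_map hX.aemeasurable
  have e : {ω | X ω = Y ω} = (fun ω => (Y ω, X ω)) ⁻¹' {q : ℝ × ℝ | q.2 = q.1} := rfl
  rw [e, ← Measure.map_apply (hY.prodMk hX) hd, h1, Measure.measure_prod_null hd]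
  exact ae_of_all _ fun y => measure_singleton y

instance nullSingletonClass_expMeasure_one : NullSingletonClass (expMeasure 1) :=
  ⟨fun x => withDensity_absolutelyContinuous _ _ (measure_singleton x)⟩

/-- The weight of `(1, 0)` enters the weight of exactly one of the two paths, and it is independent
of the other weights and has no atoms. -/
lemma measure_tie_eq_zero {s t : ℕ → Bool} {N : ℕ} (hs : s 0 = true) (ht : t 0 = false)
    (hst : stepPath s N = stepPath t N) (hN : 0 < N) :
    weightLaw {τ | weightSum τ s N = weightSum τ t N} = 0 := by
  have hs1 : stepPath s 1 = (1, 0) := by simp [stepPath, rights, ups, hs]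
  have ht1 : stepPath t 1 = (0, 1) := by simp [stepPath, rights, ups, ht]
  have hN1 : 1 < N := by
    rcases Nat.lt_or_ge 1 N with h | h
    · exact h
    · obtain rfl : N = 1 := by omega
      rw [hs1, ht1] at hst
      simp at hst
  have hone : ∀ w i, stepPath w i = (1, 0) → i = 1 := fun w i h => by
    have := rights_add_ups w i
    simp only [stepPath, Prod.mk.injEq] at h
    omega
  set S : Finset (ℤ × ℤ) := ((Finset.range N).image (stepPath s) ∪
    (Finset.range N).image (stepPath t)).erase (1, 0) with hS
  -- The weights of the two paths, with the weight of the vertex `(1, 0)` replaced by zero.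
  set E : (S → ℝ) → ℤ × ℤ → ℝ := fun y w => if h : w ∈ S then y ⟨w, h⟩ else 0 with hE
  have hEm : ∀ w, Measurable fun y => E y w := fun w => by
    by_cases h : w ∈ S
    · simp only [hE, h, dif_pos]; fun_prop
    · simp only [hE, h, dif_neg, not_false_eq_true]; fun_prop
  have hind : iIndepFun (fun (v : ℤ × ℤ) (τ : ℤ × ℤ → ℝ) => τ v) weightLaw :=
    iIndepFun_infinitePi (X := fun _ x => x) fun _ => measurable_id
  have h1 := hind.indepFun_finset {(1, 0)} S (by simp [hS]) fun v => measurable_pi_apply v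
  have hYm : Measurable fun y : S → ℝ => weightSum (E y) t N - weightSum (E y) s N := by
    unfold weightSum
    exact (Finset.measurable_sum _ fun i _ => hEm _).sub (Finset.measurable_sum _ fun i _ => hEm _)
  have h2 := h1.comp (φ := fun y : (({(1, 0)} : Finset (ℤ × ℤ)) → ℝ) => y ⟨(1, 0), by simp⟩)
    (measurable_pi_apply (X := fun _ : ({(1, 0)} : Finset (ℤ × ℤ)) => ℝ) _) hYm
  have hatom : NullSingletonClass (weightLaw.map fun τ : ℤ × ℤ → ℝ => τ (1, 0)) := by
    rw [weightLaw, Measure.infinitePi_map_eval (fun _ : ℤ × ℤ => expMeasure 1) (1, 0)]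
    infer_instance
  have h3 := measure_eq_eq_zero_of_indepFun
    (X := fun τ : ℤ × ℤ → ℝ => τ (1, 0)) (measurable_pi_apply _)
    (hYm.comp (measurable_pi_lambda _ fun i : S => measurable_pi_apply _)) h2
  refine measure_mono_null (fun τ hτ => ?_) h3
  have hEs : ∀ i ∈ Finset.range N, τ (stepPath s i)
      = E (fun i => τ i) (stepPath s i) + if i = 1 then τ (1, 0) else 0 := fun i hi => by
    by_cases h : i = 1
    · simp [h, hE, hS, hs1]
    · have h' : stepPath s i ∈ S := Finset.mem_erase.2 ⟨fun h' => h (hone s i h'),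
        Finset.mem_union_left _ (Finset.mem_image_of_mem _ hi)⟩
      simp [h, hE, h']
  have hEt : ∀ i ∈ Finset.range N, τ (stepPath t i) = E (fun i => τ i) (stepPath t i) :=
    fun i hi => by
    have h' : stepPath t i ∈ S := Finset.mem_erase.2 ⟨fun h' => by
        rw [hone t i h', ht1] at h'
        simp at h',
      Finset.mem_union_right _ (Finset.mem_image_of_mem _ hi)⟩
    simp [hE, h']
  have hw : weightSum τ s N = weightSum τ t N := hτ
  rw [weightSum, Finset.sum_congr rfl hEs, Finset.sum_add_distrib, Finset.sum_ite_eq',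
    if_pos (Finset.mem_range.2 hN1), weightSum, Finset.sum_congr rfl hEt] at hw
  change τ (1, 0) = _ - _
  simp only [weightSum]
  linarith

lemma ae_noTies : ∀ᵐ τ ∂weightLaw, NoTies τ := by
  have h : ∀ (F G : Finset ℕ) (N : ℕ), ∀ᵐ τ ∂weightLaw, finSteps F 0 = true → finSteps G 0 = false →
      stepPath (finSteps F) N = stepPath (finSteps G) N → 0 < N →
      weightSum τ (finSteps F) N ≠ weightSum τ (finSteps G) N := fun F G N => by
    by_cases hc : finSteps F 0 = true ∧ finSteps G 0 = false ∧
        stepPath (finSteps F) N = stepPath (finSteps G) N ∧ 0 < N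
    · have := measure_tie_eq_zero hc.1 hc.2.1 hc.2.2.1 hc.2.2.2
      filter_upwards [measure_eq_zero_iff_ae_notMem.1 this] with τ hτ _ _ _ _ using hτ
    · exact ae_of_all _ fun τ h1 h2 h3 h4 => absurd ⟨h1, h2, h3, h4⟩ hc
  filter_upwards [ae_all_iff.2 fun F => ae_all_iff.2 fun G => ae_all_iff.2 fun N => h F G N]
    with τ hτ s t N hs ht hst hN
  obtain ⟨F, hF⟩ := exists_finSteps s N
  obtain ⟨G, hG⟩ := exists_finSteps t N
  rw [weightSum_congr τ hF, weightSum_congr τ hG]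
  exact hτ F G N (by rw [← hF 0 hN, hs]) (by rw [← hG 0 hN, ht])
    (by rw [← stepPath_congr hF, ← stepPath_congr hG, hst]) hN

/-- The almost sure properties of weights `τ` and a direction `α` which guarantee that there is
exactly one infinite geodesic from the origin with direction `α`. -/
structure IsRegular (τ : ℤ × ℤ → ℝ) (α : ℝ) : Prop where
  mem : α ∈ Set.Ioo 0 (Real.pi / 2)
  exists_approx : HasApproxGeodesics (dirParam α) τ 0 0
  weightSum_le : ∀ q : ℚ, (0 : ℝ) < q → (q : ℝ) < 1 → ∀ᶠ k in atTop, ∀ s,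
    weightSum τ s k ≤ meanIncr q (rights s k) (ups s k) + dev k
  noTies : ∀ v, NoTies (shiftWeight τ v)
  ne_interfaceSlope : ∀ v, dirSlope α ≠ interfaceSlope (shiftWeight τ v)

lemma IsRegular.tendsto {τ : ℤ × ℤ → ℝ} {α : ℝ} (h : IsRegular τ α) {s : ℕ → Bool}
    (hs : ∃ K, ∀ k, K < k →
      meanIncr (dirParam α) (rights s k) (ups s k) - dev k ≤ weightSum τ s k) :
    Tendsto (fun k : ℕ => (rights s k : ℝ) / k) atTop (𝓝 (dirSlope α)) := by
  rw [← dirParam_sq_div h.mem]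
  refine tendsto_rights_div (dirParam_mem h.mem).1 (dirParam_mem h.mem).2 hs fun q h0 h1 => ?_
  filter_upwards [h.weightSum_le q h0 h1] with k hk using hk s

lemma hasDirection_add_iff {α : ℝ} (hα : α ∈ Set.Ioo 0 (Real.pi / 2)) {γ : ℕ → ℤ × ℤ}
    {s : ℕ → Bool} {u : ℤ × ℤ} (hγ : ∀ k, γ k = stepPath s k + u) :
    HasDirection γ α ↔ Tendsto (fun k : ℕ => (rights s k : ℝ) / k) atTop (𝓝 (dirSlope α)) := by
  rw [hasDirection_iff hα (c := u.1 + u.2) fun k => by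
    have := rights_add_ups s k
    simp only [hγ, stepPath, Prod.fst_add, Prod.snd_add]; omega]
  have h0 := tendsto_const_div_atTop_nhds_zero_nat (u.1 : ℝ)
  have e : ∀ k : ℕ, ((γ k).1 : ℝ) / k = (rights s k : ℝ) / k + u.1 / k := fun k => by
    rw [hγ, ← add_div]; simp [stepPath]
  constructor
  · intro h
    simpa [e] using h.sub h0
  · intro h
    simpa [e] using h.add h0

/-- For regular weights and directions, the car from `u` follows the translate of a path that is
determined by the approximate geodesics. -/
lemma IsRegular.exists_steps {τ : ℤ × ℤ → ℝ} {u : ℤ × ℤ} {α : ℝ}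
    (h : IsRegular (shiftWeight τ u) α) :
    ∃ s, (∀ j v, HasApproxGeodesics (dirParam α) (shiftWeight τ u) j v ↔ stepPath s j = v) ∧
      ∀ v, CarPassesThrough τ u α v ↔ ∃ k, stepPath s k + u = v := by
  obtain ⟨s, hmax, -, K, hK⟩ := h.exists_approx.exists_steps
  have hdir := h.tendsto ⟨K, hK⟩
  refine ⟨s, fun j v => ⟨fun hv => ?_, ?_⟩, fun v => ?_⟩
  · obtain ⟨t, ht, htv, hK'⟩ := hv.exists_steps
    rwa [steps_eq_of_tendsto h.noTies h.ne_interfaceSlope hmax ht hdir (h.tendsto hK')]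
  · rintro rfl
    exact ⟨K, fun N => ⟨s, hmax N, fun k _ hk => hK k hk, fun _ => rfl⟩⟩
  · have huniq : IsUniqueGeodesicInDirection τ u α fun k => stepPath s k + u := by
      refine ⟨⟨(isSemiInfiniteGeodesic_iff fun _ => rfl).2 hmax,
        (hasDirection_add_iff h.mem fun _ => rfl).2 hdir⟩, fun γ hγ hγd => ?_⟩
      obtain ⟨t, ht⟩ := exists_stepPath_infinite hγ.2.1
      rw [hγ.1] at ht
      have := steps_eq_of_tendsto h.noTies h.ne_interfaceSlope hmax
        ((isSemiInfiniteGeodesic_iff ht).1 hγ) hdir ((hasDirection_add_iff h.mem ht).1 hγd)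
      funext k
      rw [ht, this]
    constructor
    · rintro ⟨γ, hγ, k, hk⟩
      exact ⟨k, by rw [← hk, huniq.2 γ hγ.1.1 hγ.1.2]⟩
    · rintro ⟨k, hk⟩
      exact ⟨_, huniq, k, hk⟩

lemma dirSlope_injOn : Set.InjOn dirSlope (Set.Ioo 0 (Real.pi / 2)) := by
  intro a ha b hb hab
  obtain ⟨h1, h2⟩ := cos_pos_sin_pos ha
  obtain ⟨h3, h4⟩ := cos_pos_sin_pos hb
  rw [dirSlope, dirSlope, div_eq_div_iff (by positivity) (by positivity)] at hab
  have h5 : Real.sin (a - b) = 0 := by rw [Real.sin_sub]; linarith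
  have h6 := (Real.sin_eq_zero_iff_of_lt_of_lt (by linarith [ha.1, hb.2, Real.pi_pos])
    (by linarith [ha.2, hb.1, Real.pi_pos])).1 h5
  linarith

lemma measurable_dirParam : Measurable dirParam := by
  unfold dirParam; fun_prop

lemma measurable_dirSlope : Measurable dirSlope := by
  unfold dirSlope; fun_prop

/-- Weights with the exponential product law and an independent direction without atoms are almost
surely regular. -/
lemma ae_isRegular {U : Measure ℝ} [IsProbabilityMeasure U] [NullSingletonClass U]
    (hU : ∀ᵐ α ∂U, α ∈ Set.Ioo 0 (Real.pi / 2)) :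
    ∀ᵐ q ∂(weightLaw.prod U), IsRegular q.1 q.2 := by
  have h1 : ∀ᵐ q ∂(weightLaw.prod U), q.2 ∈ Set.Ioo 0 (Real.pi / 2) :=
    Measure.quasiMeasurePreserving_snd.ae hU
  have h2 : ∀ᵐ q ∂(weightLaw.prod U), HasApproxGeodesics (dirParam q.2) q.1 0 0 := by
    have hm : MeasurableSet {q : (ℤ × ℤ → ℝ) × ℝ | HasApproxGeodesics (dirParam q.2) q.1 0 0} :=
      (measurable_fst.prodMk (measurable_dirParam.comp measurable_snd))
        (measurableSet_hasApproxGeodesics 0 0)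
    refine (Measure.ae_prod_iff_ae_ae hm).2 ?_
    rw [Measure.ae_ae_comm hm]
    filter_upwards [hU] with α hα using ae_hasApproxGeodesics ⟨dirParam α, dirParam_mem hα⟩
  have h3 : ∀ᵐ τ ∂weightLaw, ∀ q : ℚ, (0 : ℝ) < q → (q : ℝ) < 1 → ∀ᶠ k in atTop, ∀ s,
      weightSum τ s k ≤ meanIncr q (rights s k) (ups s k) + dev k := by
    refine ae_all_iff.2 fun q => ?_
    by_cases hq : (0 : ℝ) < q ∧ (q : ℝ) < 1
    · filter_upwards [ae_eventually_weightSum_le ⟨q, hq⟩] with τ hτ _ _ using hτ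
    · exact ae_of_all _ fun τ h0 h1 => absurd ⟨h0, h1⟩ hq
  have h4 : ∀ᵐ τ ∂weightLaw, ∀ v, NoTies (shiftWeight τ v) :=
    ae_all_iff.2 fun v => (measurePreserving_shiftWeight v).quasiMeasurePreserving.ae ae_noTies
  have h5 : ∀ᵐ q ∂(weightLaw.prod U), ∀ v, dirSlope q.2 ≠ interfaceSlope (shiftWeight q.1 v) := by
    refine ae_all_iff.2 fun v => ?_
    have hm : MeasurableSet
        {q : (ℤ × ℤ → ℝ) × ℝ | dirSlope q.2 ≠ interfaceSlope (shiftWeight q.1 v)} :=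
      (measurableSet_eq_fun (measurable_dirSlope.comp measurable_snd)
        ((measurable_interfaceSlope.comp (measurable_shiftWeight v)).comp measurable_fst)).compl
    refine (Measure.ae_prod_iff_ae_ae hm).2 (ae_of_all _ fun τ => ?_)
    have hsub : (Set.Ioo 0 (Real.pi / 2) ∩
        {α | dirSlope α = interfaceSlope (shiftWeight τ v)}).Subsingleton :=
      fun a ha b hb => dirSlope_injOn ha.1 hb.1 (ha.2.trans hb.2.symm)
    filter_upwards [hU, measure_eq_zero_iff_ae_notMem.1 (hsub.measure_zero U)] with α hα hα' h
    exact hα' ⟨hα, h⟩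
  filter_upwards [h1, h2, Measure.quasiMeasurePreserving_fst.ae h3,
    Measure.quasiMeasurePreserving_fst.ae h4, h5] with q a b c d e
  exact ⟨a, b, c, d, e⟩

end LPP

theorem theorem2p2 {Ω : Type*} [MeasurableSpace Ω] (P : Measure Ω) [IsProbabilityMeasure P]
    (ε : ℝ) (hε : 0 < ε) (hε' : ε < Real.pi / 4)
    (τ θ : ℤ × ℤ → Ω → ℝ)
    (hτ_meas : ∀ v, Measurable (τ v)) (hθ_meas : ∀ v, Measurable (θ v))
    (hτ_law : ∀ v, P.map (τ v) = expMeasure 1)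
    (hθ_law : ∀ v, pdf.IsUniform (θ v) (Set.Ioo ε (Real.pi / 2 - ε)) P volume)
    (hτ_indep : iIndepFun τ P) (hθ_indep : iIndepFun θ P)
    (hτθ_indep : IndepFun (fun ω v => τ v ω) (fun ω v => θ v ω) P)
    (n : ℕ) :
    AEMeasurable (fun ω => LPP.numCars (fun v => τ v ω) (fun v => θ v ω) n) P ∧
      ∫⁻ ω, LPP.numCars (fun v => τ v ω) (fun v => θ v ω) n ∂P = 1 := by
  set U : Measure ℝ := P.map (θ 0) with hU
  have hUv : ∀ v, P.map (θ v) = U := fun v => (hθ_law v).trans (hθ_law 0).symm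
  have : IsProbabilityMeasure U := Measure.isProbabilityMeasure_map (hθ_meas 0).aemeasurable
  have hUc : U = cond volume (Set.Ioo ε (Real.pi / 2 - ε)) := hθ_law 0
  have : NullSingletonClass U := ⟨fun x => by
    rw [hUc]; exact cond_absolutelyContinuous (measure_singleton x)⟩
  have hUmem : ∀ᵐ α ∂U, α ∈ Set.Ioo 0 (Real.pi / 2) := by
    rw [hUc]
    filter_upwards [ae_cond_mem measurableSet_Ioo] with α hα
    exact ⟨hε.trans hα.1, by linarith [hα.2]⟩
  have hτ_joint : P.map (fun ω v => τ v ω) = LPP.weightLaw := by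
    rw [hτ_indep.map_fun_eq_infinitePi_map hτ_meas, LPP.weightLaw]
    simp only [hτ_law]
  -- The environment and the direction seen by the car that starts from `u`.
  set Φ : ℤ × ℤ → Ω → (ℤ × ℤ → ℝ) × ℝ :=
    fun u ω => (LPP.shiftWeight (fun v => τ v ω) u, θ u ω) with hΦ
  have hτm : Measurable fun ω v => τ v ω := measurable_pi_lambda _ hτ_meas
  have hΦp : ∀ u, MeasurePreserving (Φ u) P (LPP.weightLaw.prod U) := fun u => by
    have hm := (LPP.measurable_shiftWeight u).comp hτm
    refine ⟨hm.prodMk (hθ_meas u), ?_⟩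
    have h := hτθ_indep.comp (LPP.measurable_shiftWeight u) (measurable_pi_apply u)
    have h' := (indepFun_iff_map_prod_eq_prod_map_map hm.aemeasurable (hθ_meas u).aemeasurable).1 h
    rw [show P.map (Φ u) = _ from h', ← Measure.map_map (LPP.measurable_shiftWeight u) hτm,
      hτ_joint,
      (LPP.measurePreserving_shiftWeight u).map_eq, show P.map (θ u) = U from hUv u]
  have hreg := LPP.ae_isRegular hUmem
  set A : ℤ × ℤ → Set ((ℤ × ℤ → ℝ) × ℝ) := fun v =>
    {q | LPP.HasApproxGeodesics (LPP.dirParam q.2) q.1 n v} with hA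
  have hAm : ∀ v, MeasurableSet (A v) := fun v =>
    (measurable_fst.prodMk (LPP.measurable_dirParam.comp measurable_snd))
      (LPP.measurableSet_hasApproxGeodesics n v)
  set f : ℤ × ℤ → (ℤ × ℤ → ℝ) × ℝ → ℝ≥0∞ := fun v =>
    if v.1 + v.2 = (n : ℤ) then (A v).indicator 1 else 0 with hf
  have hfm : ∀ v, Measurable (f v) := fun v => by
    simp only [hf]
    split_ifs
    · exact measurable_one.indicator (hAm v)
    · exact measurable_zero
  have hf_one : ∀ v q, v.1 + v.2 = (n : ℤ) → q ∈ A v → f v q = 1 := fun v q h1 h2 => by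
    simp only [hf, h1, if_true]
    exact Set.indicator_of_mem h2 _
  have hf_zero : ∀ v q, ¬ (v.1 + v.2 = (n : ℤ) ∧ q ∈ A v) → f v q = 0 := fun v q h => by
    simp only [hf]
    split_ifs with h1
    · exact Set.indicator_of_notMem (fun h2 => h ⟨h1, h2⟩) _
    · rfl
  have hnum : ∀ᵐ ω ∂P, LPP.numCars (fun v => τ v ω) (fun v => θ v ω) n = ∑' u, f (-u) (Φ u ω) := by
    filter_upwards [ae_all_iff.2 fun u => (hΦp u).quasiMeasurePreserving.ae hreg] with ω hω
    rw [LPP.numCars, ← ENNReal.tsum_set_one, tsum_subtype _ fun _ => (1 : ℝ≥0∞)]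
    refine tsum_congr fun u => ?_
    obtain ⟨s, hs1, hs2⟩ :=
      LPP.IsRegular.exists_steps (τ := fun v => τ v ω) (u := u) (α := θ u ω) (hω u)
    have hline : (-u).1 + (-u).2 = (n : ℤ) ↔ u.1 + u.2 = -(n : ℤ) := by
      simp only [Prod.fst_neg, Prod.snd_neg]; omega
    have hcar : u.1 + u.2 = -(n : ℤ) →
        (LPP.CarPassesThrough (fun v => τ v ω) u (θ u ω) (0, 0) ↔ Φ u ω ∈ A (-u)) := fun hu => by
      rw [hs2]
      refine Iff.trans ?_ (hs1 n (-u)).symm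
      constructor
      · rintro ⟨k, hk⟩
        have hk' := eq_neg_of_add_eq_zero_left hk
        have h3 := LPP.rights_add_ups s k
        have h4 := hline.2 hu
        rw [← hk'] at h4
        simp only [LPP.stepPath] at h4
        obtain rfl : k = n := by omega
        exact hk'
      · intro h
        exact ⟨n, by rw [h, neg_add_cancel]; rfl⟩
    by_cases hc : u ∈ {u : ℤ × ℤ | u.1 + u.2 = -(n : ℤ) ∧
        LPP.CarPassesThrough (fun v => τ v ω) u (θ u ω) (0, 0)}
    · rw [Set.indicator_of_mem hc, hf_one _ _ (hline.2 hc.1) ((hcar hc.1).1 hc.2)]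
    · rw [Set.indicator_of_notMem hc, hf_zero]
      rintro ⟨h1, h2⟩
      exact hc ⟨hline.1 h1, (hcar (hline.1 h1)).2 h2⟩
  have hfΦ : ∀ u, Measurable fun ω => f (-u) (Φ u ω) := fun u => (hfm _).comp (hΦp u).measurable
  refine ⟨⟨_, Measurable.tsum hfΦ, hnum⟩, ?_⟩
  rw [lintegral_congr_ae hnum, lintegral_tsum fun u => (hfΦ u).aemeasurable]
  -- By translation invariance, count the vertices on the line `x + y = n` visited by a single car.
  have h1 : ∀ u, ∫⁻ ω, f (-u) (Φ u ω) ∂P = ∫⁻ q, f (-u) q ∂(LPP.weightLaw.prod U) := fun u =>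
    (hΦp u).lintegral_comp (hfm _)
  simp only [h1]
  have hneg : ∑' u, ∫⁻ q, f (-u) q ∂(LPP.weightLaw.prod U)
      = ∑' v, ∫⁻ q, f v q ∂(LPP.weightLaw.prod U) :=
    (Equiv.neg (ℤ × ℤ)).tsum_eq fun v => ∫⁻ q, f v q ∂(LPP.weightLaw.prod U)
  rw [hneg, ← lintegral_tsum fun v => (hfm v).aemeasurable]
  have h2 : ∀ᵐ q ∂(LPP.weightLaw.prod U), ∑' v, f v q = 1 := by
    filter_upwards [hreg] with q hq
    have e : LPP.shiftWeight q.1 0 = q.1 := by funext v; simp [LPP.shiftWeight]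
    obtain ⟨s, hs, -⟩ := LPP.IsRegular.exists_steps (τ := q.1) (u := 0) (by rwa [e])
    rw [e] at hs
    rw [tsum_eq_single (LPP.stepPath s n)]
    · have h3 := LPP.rights_add_ups s n
      refine hf_one _ _ ?_ ((hs n _).2 rfl)
      simp only [LPP.stepPath]
      omega
    · intro v hv
      exact hf_zero _ _ fun h => hv ((hs n v).1 h.2).symm
  rw [lintegral_congr_ae h2]
  simp
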